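/- Let $K:\mathbb{R}^2\to\mathbb{R}$ be measurable and locally bounded, with $K\le 0$ and $K$ not almost everywhere equal to $0$. For $p\ge 1$ put $$\alpha_p(K)=\sup\Big\{a\in\mathbb{R}:\ \int_{\mathbb{R}^2}|K(x)|^p(1+|x|)^{2ap+2(p-1)}\,dx<+\infty\Big\}\in[-\infty,+\infty],\qquad \sup\emptyset=-\infty .$$ Assume that $\alpha_1(K)>0$ and that there exists $p>1$ with $\alpha_p(K)>-\infty$. Then for every real $\alpha\in(0,\alpha_1(K))$ the equation $$\Delta u+K(x)e^{2u}=0\quad\text{in }\mathbb{R}^2$$ has exactly one continuous solution $u_\alpha$ (in the sense of distributions) satisfying $u_\alpha(x)=\alpha\ln|x|+O(1)$ as $|x|\to\infty$. Moreover, $Ke^{2u_\alpha}\in L^1(\mathbb{R}^2)$ and the total curvature is $$\int_{\mathbb{R}^2}K e^{2u_\alpha}\,dx=-2\alpha\pi,$$ and there exists $c_\alpha\in\mathbb{R}$ such that for every $\beta\in(0,\alpha_1(K)-\alpha)$, $$u_\alpha(x)=\alpha\ln|x|+c_\alpha+o\Big(|x|^{-\frac{2\beta}{1+2\beta}}\Big)\quad\text{as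 }|x|\to\infty .$$ -/

import Mathlib

open MeasureTheory Filter Asymptotics
open scoped ContDiff

/-- The Euclidean plane. -/
abbrev Plane : Type := EuclideanSpace ℝ (Fin 2)

/-- `alphaExp K p` is `α_p(K)`: the supremum, in `[-∞, +∞]`, of the real numbers `a` with
`∫ |K(x)|^p (1 + |x|)^(2 a p + 2 (p - 1)) dx < +∞`; the supremum of the empty set is `-∞`. -/
noncomputable def alphaExp (K : Plane → ℝ) (p : ℝ) : EReal :=
  sSup ((fun a : ℝ => (a : EReal)) ''
    {a : ℝ | ∫⁻ x : Plane,
      ENNReal.ofReal (|K x| ^ p * (1 + ‖x‖) ^ (2 * a * p + 2 * (p - 1))) < ⊤})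

/-- Local (essential) boundedness: `K` is bounded, up to a null set, on every ball. -/
def IsLocBounded (K : Plane → ℝ) : Prop :=
  ∀ R : ℝ, ∃ C : ℝ, ∀ᵐ x : Plane, ‖x‖ ≤ R → |K x| ≤ C

/-- `u` is a continuous solution of `Δu + K e^{2u} = 0` in the plane, in the sense of
distributions. For measurable, locally bounded `K` both integrands are integrable. -/
structure IsCurvatureSolution (K u : Plane → ℝ) : Prop where
  continuous : Continuous u
  weak : ∀ φ : Plane → ℝ, ContDiff ℝ ∞ φ → HasCompactSupport φ →
    (∫ x, u x * Laplacian.laplacian φ x) + ∫ x, K x * Real.exp (2 * u x) * φ x = 0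

/-- `u(x) = α ln |x| + O(1)` as `|x| → ∞`. -/
def HasLogGrowth (α : ℝ) (u : Plane → ℝ) : Prop :=
  (fun x : Plane => u x - α * Real.log ‖x‖) =O[cocompact Plane] (fun _ : Plane => (1 : ℝ))

/-!
The difference of a solution `u` with logarithmic growth and the logarithmic potential of
`|K| e^{2u}` is weakly harmonic and grows at most logarithmically, hence is constant by Liouville's
theorem. So the problem is equivalent to the integral equation `u = c + logPot (|K| e^{2u})` with
`∫ |K| e^{2u} = 2πα`, and the expansion of `u` at infinity is that of the potential.

Uniqueness is a maximum principle: if `u - v` were positive at its maximum, up to an additive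
constant, then `|K| (e^{2u} - e^{2v})` would be nonnegative nearby, and its potential subharmonic.

For existence, write the density as `h = (m + g) F` with `F = |K| (1 + |x|)^{2α}`. The integral
equation becomes `½ log (m + g) = c + logPot (g F) - b` with `b` bounded. On the functions of
mean zero in `L²(F dx)`, the operator `g ↦ -logPot (g F)` is nonnegative, because `-log |x - y|` is
a conditionally positive definite kernel; hence once `log` is truncated to a bi-Lipschitz function,
the equation is strongly monotone and solvable. The maximum principle bounds its solution
independently of the truncation.
-/

section LogKernel

theorem log_one_add_le_rpow_div {s a : ℝ} (hs : 0 < s) (hs1 : s ≤ 1) (ha : 0 ≤ a) :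
    Real.log (1 + a) ≤ a ^ s / s := by
  rw [le_div_iff₀ hs, mul_comm, ← Real.log_rpow (by linarith)]
  calc Real.log ((1 + a) ^ s) ≤ Real.log (1 + a ^ s) := by
        gcongr
        simpa using Real.rpow_add_le_add_rpow zero_le_one ha hs.le hs1
    _ ≤ a ^ s := by linarith [Real.log_le_sub_one_of_pos (x := 1 + a ^ s) (by positivity)]

theorem abs_log_le_rpow_add_rpow_neg {s r : ℝ} (hs : 0 < s) (hr : 0 ≤ r) :
    |Real.log r| ≤ s⁻¹ * (r ^ s + r ^ (-s)) := by
  have hupper := Real.log_le_rpow_div hr hs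
  have hlower := Real.log_le_rpow_div (inv_nonneg.2 hr) hs
  rw [Real.log_inv, Real.inv_rpow hr, ← Real.rpow_neg hr] at hlower
  have hpos : 0 ≤ r ^ s / s := by positivity
  have hneg : 0 ≤ r ^ (-s) / s := by positivity
  rw [mul_add, ← div_eq_inv_mul, ← div_eq_inv_mul, abs_le]
  constructor <;> linarith

theorem abs_log_sub_log_one_add_le {r : ℝ} (hr : 1 ≤ r) :
    |Real.log r - Real.log (1 + r)| ≤ Real.log 2 := by
  have hr0 : 0 < r := by linarith
  have hle := Real.log_le_log hr0 (show r ≤ 1 + r by linarith)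
  have hge := Real.log_le_log (by positivity) (show 1 + r ≤ 2 * r by linarith)
  rw [Real.log_mul two_ne_zero hr0.ne'] at hge
  rw [abs_le]
  constructor <;> linarith [Real.log_nonneg one_le_two]

theorem rpow_neg_le_two_mul_rpow_neg {γ a b : ℝ} (hγ : 0 ≤ γ) (hγ1 : γ ≤ 1) (ha : 0 < a)
    (hab : a / 2 ≤ b) : b ^ (-γ) ≤ 2 * a ^ (-γ) :=
  calc b ^ (-γ) ≤ (a / 2) ^ (-γ) :=
        Real.rpow_le_rpow_of_nonpos (by positivity) hab (by linarith)
    _ = 2 ^ γ * a ^ (-γ) := by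
        rw [Real.div_rpow ha.le zero_le_two, Real.rpow_neg zero_le_two, div_inv_eq_mul, mul_comm]
    _ ≤ 2 * a ^ (-γ) := by
        gcongr
        simpa using Real.rpow_le_rpow_of_exponent_le one_le_two hγ1

variable {E : Type*} [NormedAddCommGroup E] {τ τ' γ s s' : ℝ} {x y : E}

theorem one_le_one_add_norm_rpow (hτ : 0 ≤ τ) (y : E) : 1 ≤ (1 + ‖y‖) ^ τ :=
  Real.one_le_rpow (by linarith [norm_nonneg y]) hτ

theorem norm_sub_rpow_le_mul_rpow (hs : 0 ≤ s) (x y : E) :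
    ‖x - y‖ ^ s ≤ (1 + ‖x‖) ^ s * (1 + ‖y‖) ^ s := by
  rw [← Real.mul_rpow (by positivity) (by positivity)]
  refine Real.rpow_le_rpow (norm_nonneg _) ((norm_sub_le x y).trans ?_) hs
  nlinarith [mul_nonneg (norm_nonneg x) (norm_nonneg y)]

theorem log_norm_sub_log_norm_le (hs : 0 < s) (hs1 : s ≤ 1) (hx : x ≠ 0) (hy : y ≠ 0) :
    Real.log ‖x‖ - Real.log ‖y‖ ≤ s⁻¹ * (‖x - y‖ ^ s * ‖y‖ ^ (-s)) := by
  have hx' := norm_pos_iff.2 hx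
  have hy' := norm_pos_iff.2 hy
  have hratio : ‖x‖ / ‖y‖ ≤ 1 + ‖x - y‖ / ‖y‖ := by
    rw [div_le_iff₀ hy', add_mul, div_mul_cancel₀ _ hy'.ne', one_mul]
    exact norm_le_norm_add_norm_sub' x y
  calc Real.log ‖x‖ - Real.log ‖y‖ = Real.log (‖x‖ / ‖y‖) := (Real.log_div hx'.ne' hy'.ne').symm
    _ ≤ Real.log (1 + ‖x - y‖ / ‖y‖) := by gcongr
    _ ≤ (‖x - y‖ / ‖y‖) ^ s / s := log_one_add_le_rpow_div hs hs1 (by positivity)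
    _ = s⁻¹ * (‖x - y‖ ^ s * ‖y‖ ^ (-s)) := by
        rw [Real.div_rpow (norm_nonneg _) hy'.le, Real.rpow_neg hy'.le]
        field_simp

theorem abs_log_norm_sub_log_norm_le (hs : 0 < s) (hs1 : s ≤ 1) (hx : x ≠ 0) (hy : y ≠ 0) :
    |Real.log ‖x‖ - Real.log ‖y‖| ≤ s⁻¹ * (‖x - y‖ ^ s * (‖x‖ ^ (-s) + ‖y‖ ^ (-s))) := by
  have hxy := log_norm_sub_log_norm_le hs hs1 hx hy
  have hyx := log_norm_sub_log_norm_le hs hs1 hy hx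
  rw [norm_sub_rev] at hyx
  have hxs : 0 ≤ s⁻¹ * (‖x - y‖ ^ s * ‖x‖ ^ (-s)) := by positivity
  have hys : 0 ≤ s⁻¹ * (‖x - y‖ ^ s * ‖y‖ ^ (-s)) := by positivity
  rw [abs_le]
  constructor <;> linarith

theorem abs_log_norm_sub_sub_log_norm_sub_le {z : E} (hs : 0 < s) (hs1 : s ≤ 1) (hx : x ≠ z)
    (hy : y ≠ z) :
    |Real.log ‖x - z‖ - Real.log ‖y - z‖| ≤
      s⁻¹ * (‖x - y‖ ^ s * (‖x - z‖ ^ (-s) + ‖y - z‖ ^ (-s))) := by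
  simpa using abs_log_norm_sub_log_norm_le hs hs1 (sub_ne_zero.2 hx) (sub_ne_zero.2 hy)

/-- The weight against which densities of logarithmic potentials are integrated: of growth `τ` at
infinity and with a singularity of order `s` at `x`. The two effects are multiplied, so that one
weight dominates both the kernel `log ‖x - y‖` and its deviation from `log ‖x‖`. -/
noncomputable def potWeight (τ s : ℝ) (x y : E) : ℝ := (1 + ‖y‖) ^ τ * (1 + ‖x - y‖ ^ (-s))

theorem potWeight_nonneg (τ s : ℝ) (x y : E) : 0 ≤ potWeight τ s x y := by
  unfold potWeight
  positivity

theorem one_le_potWeight (hτ : 0 ≤ τ) (s : ℝ) (x y : E) : 1 ≤ potWeight τ s x y :=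
  one_le_mul_of_one_le_of_one_le (one_le_one_add_norm_rpow hτ y)
    (le_add_of_nonneg_right (by positivity))

theorem norm_sub_rpow_neg_le_potWeight (hτ : 0 ≤ τ) (s : ℝ) (x y : E) :
    ‖x - y‖ ^ (-s) ≤ potWeight τ s x y :=
  calc ‖x - y‖ ^ (-s) ≤ 1 * (1 + ‖x - y‖ ^ (-s)) := by linarith
    _ ≤ (1 + ‖y‖) ^ τ * (1 + ‖x - y‖ ^ (-s)) := by
        gcongr
        exact one_le_one_add_norm_rpow hτ y

@[fun_prop]
theorem measurable_potWeight [MeasurableSpace E] [BorelSpace E] (τ s : ℝ) (x : E) :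
    Measurable (potWeight τ s x) := by
  unfold potWeight
  fun_prop

theorem rpow_neg_le_one_add_rpow_neg {r : ℝ} (hr : 0 ≤ r) (hs' : 0 ≤ s') (hs : s' ≤ s) :
    r ^ (-s') ≤ 1 + r ^ (-s) := by
  rcases hr.eq_or_lt with rfl | hr
  · have hle_one : (0 : ℝ) ^ (-s') ≤ 1 := Real.zero_rpow_le_one _
    have hnonneg : 0 ≤ (0 : ℝ) ^ (-s) := Real.rpow_nonneg le_rfl _
    linarith
  rcases le_total 1 r with h | h
  · have hle_one : r ^ (-s') ≤ 1 := Real.rpow_le_one_of_one_le_of_nonpos h (by linarith)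
    have hnonneg : 0 ≤ r ^ (-s) := by positivity
    linarith
  · linarith [Real.rpow_le_rpow_of_exponent_ge hr h (neg_le_neg hs)]

theorem potWeight_le_two_mul (hτ : τ' ≤ τ) (hs' : 0 ≤ s') (hs : s' ≤ s) (x y : E) :
    potWeight τ' s' x y ≤ 2 * potWeight τ s x y := by
  have hsing : 1 + ‖x - y‖ ^ (-s') ≤ 2 * (1 + ‖x - y‖ ^ (-s)) := by
    have hnonneg : 0 ≤ ‖x - y‖ ^ (-s) := by positivity
    linarith [rpow_neg_le_one_add_rpow_neg (norm_nonneg (x - y)) hs' hs]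
  calc potWeight τ' s' x y ≤ (1 + ‖y‖) ^ τ * (2 * (1 + ‖x - y‖ ^ (-s))) := by
        unfold potWeight
        gcongr
        linarith [norm_nonneg y]
    _ = 2 * potWeight τ s x y := by rw [potWeight]; ring

theorem abs_log_norm_sub_le_potWeight (hs : 0 < s) (x y : E) :
    |Real.log ‖x - y‖| ≤ s⁻¹ * (1 + ‖x‖) ^ s * potWeight s s x y := by
  have hgrowth : 1 ≤ (1 + ‖x‖) ^ s * (1 + ‖y‖) ^ s :=
    one_le_mul_of_one_le_of_one_le (one_le_one_add_norm_rpow hs.le x)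
      (one_le_one_add_norm_rpow hs.le y)
  calc |Real.log ‖x - y‖|
      ≤ s⁻¹ * (‖x - y‖ ^ s + 1 * ‖x - y‖ ^ (-s)) := by
        rw [one_mul]
        exact abs_log_le_rpow_add_rpow_neg hs (norm_nonneg _)
    _ ≤ s⁻¹ * ((1 + ‖x‖) ^ s * (1 + ‖y‖) ^ s +
          (1 + ‖x‖) ^ s * (1 + ‖y‖) ^ s * ‖x - y‖ ^ (-s)) := by
        gcongr
        exact norm_sub_rpow_le_mul_rpow hs.le x y
    _ = s⁻¹ * (1 + ‖x‖) ^ s * potWeight s s x y := by rw [potWeight]; ring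

theorem abs_log_norm_sub_sub_log_norm_le_potWeight (hγ : 0 < γ) (hs : 0 < s) (hγs : γ + s ≤ 1)
    (hx : x ≠ 0) (hxy : x ≠ y) :
    |Real.log ‖x - y‖ - Real.log ‖x‖| ≤
      (4 / s + 3 / γ) * ‖x‖ ^ (-γ) * potWeight (γ + s) s x y := by
  have hx' := norm_pos_iff.2 hx
  have hxy' := norm_pos_iff.2 (sub_ne_zero.2 hxy)
  have hincr : ‖x - y - x‖ = ‖y‖ := by rw [sub_sub_cancel_left, norm_neg]
  rw [potWeight]
  -- Compare exponents `γ` or `s` according to whether the singularity `y` is far from `x` or not.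
  rcases le_or_gt (‖x‖ / 2) ‖x - y‖ with hfar | hnear
  · have hlog := abs_log_norm_sub_log_norm_le hγ (by linarith) (sub_ne_zero.2 hxy) hx
    rw [hincr] at hlog
    have hxyγ : ‖x - y‖ ^ (-γ) ≤ 2 * ‖x‖ ^ (-γ) :=
      rpow_neg_le_two_mul_rpow_neg hγ.le (by linarith) hx' hfar
    have hyγ : ‖y‖ ^ γ ≤ (1 + ‖y‖) ^ (γ + s) :=
      (Real.rpow_le_rpow (norm_nonneg _) (by linarith) hγ.le).trans
        (Real.rpow_le_rpow_of_exponent_le (by linarith [norm_nonneg y]) (by linarith))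
    calc _ ≤ _ := hlog
      _ ≤ γ⁻¹ * ((1 + ‖y‖) ^ (γ + s) * (2 * ‖x‖ ^ (-γ) + ‖x‖ ^ (-γ))) := by gcongr
      _ = (0 + 3 / γ) * ‖x‖ ^ (-γ) * ((1 + ‖y‖) ^ (γ + s) * (1 + 0)) := by ring
      _ ≤ _ := by gcongr <;> positivity
  · have hlog := abs_log_norm_sub_log_norm_le hs (by linarith) (sub_ne_zero.2 hxy) hx
    rw [hincr] at hlog
    have hy : ‖x‖ / 2 ≤ ‖y‖ := by
      have := norm_le_norm_add_norm_sub' x (x - y)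
      rw [sub_sub_cancel] at this
      linarith
    have hxs : ‖x‖ ^ (-s) ≤ ‖x - y‖ ^ (-s) :=
      Real.rpow_le_rpow_of_nonpos hxy' (by linarith) (by linarith)
    have hys : ‖y‖ ^ s ≤ (1 + ‖y‖) ^ (γ + s) * (2 * ‖x‖ ^ (-γ)) := by
      calc ‖y‖ ^ s = ‖y‖ ^ (γ + s) * ‖y‖ ^ (-γ) := by
            rw [← Real.rpow_add (by linarith)]
            congr 1
            ring
        _ ≤ _ := by
            gcongr
            · linarith
            · exact rpow_neg_le_two_mul_rpow_neg hγ.le (by linarith) hx' hy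
    calc _ ≤ _ := hlog
      _ ≤ s⁻¹ * ((1 + ‖y‖) ^ (γ + s) * (2 * ‖x‖ ^ (-γ)) *
            (‖x - y‖ ^ (-s) + ‖x - y‖ ^ (-s))) := by gcongr
      _ = (4 / s + 0) * ‖x‖ ^ (-γ) * ((1 + ‖y‖) ^ (γ + s) * (0 + ‖x - y‖ ^ (-s))) := by ring
      _ ≤ _ := by gcongr <;> positivity

end LogKernel

/-- Densities whose logarithmic potential is under control: the integrals of `|h|` against the
weights `potWeight τ s x` are bounded uniformly in `x`. -/
structure PotAdmissible {E : Type*} [NormedAddCommGroup E] [MeasureSpace E] (τ s : ℝ)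
    (h : E → ℝ) : Prop where
  aestronglyMeasurable : AEStronglyMeasurable h volume
  exists_integral_le : ∃ C, ∀ x, Integrable (fun y => potWeight τ s x y * |h y|) ∧
    ∫ y, potWeight τ s x y * |h y| ≤ C

namespace PotAdmissible

variable {E : Type*} [NormedAddCommGroup E] [MeasureSpace E] {τ τ' s s' : ℝ} {h k g : E → ℝ}

theorem exists_integral_abs_mul_le (hh : PotAdmissible τ s h) :
    ∃ C, 0 ≤ C ∧ ∀ (g : E → ℝ) (c : ℝ) (x : E), 0 ≤ c →
      (∀ᵐ y, |g y| ≤ c * potWeight τ s x y) → ∫ y, |g y * h y| ≤ c * C := by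
  obtain ⟨C, hC⟩ := hh.exists_integral_le
  refine ⟨|C|, abs_nonneg _, fun g c x hc hle => ?_⟩
  calc ∫ y, |g y * h y| ≤ ∫ y, c * (potWeight τ s x y * |h y|) := by
        refine integral_mono_of_nonneg (Eventually.of_forall fun _ => abs_nonneg _)
          ((hC x).1.const_mul c) ?_
        filter_upwards [hle] with y hy
        rw [abs_mul, ← mul_assoc]
        gcongr
    _ = c * ∫ y, potWeight τ s x y * |h y| := integral_const_mul ..
    _ ≤ c * |C| := by
        gcongr
        exact (hC x).2.trans (le_abs_self C)

theorem integrable_mul (hh : PotAdmissible τ s h) (hg : AEStronglyMeasurable g volume) {c : ℝ}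
    (x : E) (hle : ∀ᵐ y, |g y| ≤ c * potWeight τ s x y) : Integrable (fun y => g y * h y) := by
  obtain ⟨C, hC⟩ := hh.exists_integral_le
  refine ((hC x).1.const_mul c).mono' (hg.mul hh.aestronglyMeasurable) ?_
  filter_upwards [hle] with y hy
  rw [norm_mul, Real.norm_eq_abs, Real.norm_eq_abs, ← mul_assoc]
  gcongr

theorem integrable (hh : PotAdmissible τ s h) (hτ : 0 ≤ τ) : Integrable h := by
  simpa using hh.integrable_mul (g := fun _ => 1) aestronglyMeasurable_const (c := 1) 0
    (Eventually.of_forall fun y => by simpa using one_le_potWeight hτ s 0 y)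

variable [BorelSpace E]

theorem of_weight_mul_le (hh : PotAdmissible τ s h) (hk : AEStronglyMeasurable k volume) (c : ℝ)
    (hle : ∀ᵐ y, ∀ x, potWeight τ' s' x y * |k y| ≤ c * (potWeight τ s x y * |h y|)) :
    PotAdmissible τ' s' k := by
  obtain ⟨C, hC⟩ := hh.exists_integral_le
  refine ⟨hk, |c| * C, fun x => ?_⟩
  have hle' : ∀ᵐ y, potWeight τ' s' x y * |k y| ≤ |c| * (potWeight τ s x y * |h y|) := by
    filter_upwards [hle] with y hy
    exact (hy x).trans (mul_le_mul_of_nonneg_right (le_abs_self c)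
      (mul_nonneg (potWeight_nonneg _ _ _ _) (abs_nonneg _)))
  have hint : Integrable (fun y => potWeight τ' s' x y * |k y|) := by
    refine ((hC x).1.const_mul |c|).mono'
      ((measurable_potWeight τ' s' x).aestronglyMeasurable.mul hk.norm) ?_
    filter_upwards [hle'] with y hy
    rwa [Real.norm_of_nonneg (mul_nonneg (potWeight_nonneg _ _ _ _) (abs_nonneg _))]
  refine ⟨hint, ?_⟩
  calc ∫ y, potWeight τ' s' x y * |k y| ≤ ∫ y, |c| * (potWeight τ s x y * |h y|) :=
        integral_mono_ae hint ((hC x).1.const_mul |c|) hle'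
    _ = |c| * ∫ y, potWeight τ s x y * |h y| := integral_const_mul ..
    _ ≤ |c| * C := by
        gcongr
        exact (hC x).2

theorem mono (hh : PotAdmissible τ s h) (hτ : τ' ≤ τ) (hs' : 0 ≤ s') (hs : s' ≤ s) :
    PotAdmissible τ' s' h :=
  hh.of_weight_mul_le hh.aestronglyMeasurable 2 (Eventually.of_forall fun y x => by
    rw [← mul_assoc]
    exact mul_le_mul_of_nonneg_right (potWeight_le_two_mul hτ hs' hs x y) (abs_nonneg _))

theorem of_abs_le (hh : PotAdmissible τ s h) (hk : AEStronglyMeasurable k volume) (c : ℝ)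
    (hle : ∀ᵐ y, |k y| ≤ c * |h y|) : PotAdmissible τ s k :=
  hh.of_weight_mul_le hk c (by
    filter_upwards [hle] with y hy x
    rw [mul_left_comm c]
    exact mul_le_mul_of_nonneg_left hy (potWeight_nonneg _ _ _ _))

theorem sub (hh : PotAdmissible τ s h) (hk : PotAdmissible τ s k) :
    PotAdmissible τ s (fun y => h y - k y) := by
  obtain ⟨C, hC⟩ := hh.exists_integral_le
  obtain ⟨D, hD⟩ := hk.exists_integral_le
  refine ⟨hh.aestronglyMeasurable.sub hk.aestronglyMeasurable, C + D, fun x => ?_⟩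
  have hle : ∀ y, potWeight τ s x y * |h y - k y| ≤
      potWeight τ s x y * |h y| + potWeight τ s x y * |k y| := fun y => by
    rw [← mul_add]
    exact mul_le_mul_of_nonneg_left (abs_sub _ _) (potWeight_nonneg _ _ _ _)
  have hsum := (hC x).1.add (hD x).1
  have hint : Integrable (fun y => potWeight τ s x y * |h y - k y|) := by
    refine hsum.mono' ((measurable_potWeight τ s x).aestronglyMeasurable.mul
      (hh.aestronglyMeasurable.sub hk.aestronglyMeasurable).norm) (Eventually.of_forall fun y => ?_)
    rw [Real.norm_of_nonneg (mul_nonneg (potWeight_nonneg _ _ _ _) (abs_nonneg _))]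
    exact hle y
  refine ⟨hint, ?_⟩
  calc ∫ y, potWeight τ s x y * |h y - k y|
      ≤ ∫ y, (potWeight τ s x y * |h y| + potWeight τ s x y * |k y|) :=
        integral_mono hint hsum hle
    _ = (∫ y, potWeight τ s x y * |h y|) + ∫ y, potWeight τ s x y * |k y| :=
        integral_add (hC x).1 (hD x).1
    _ ≤ C + D := add_le_add (hC x).2 (hD x).2

theorem integrable_log_mul (hh : PotAdmissible s s h) (hs : 0 < s) (x : E) :
    Integrable (fun y => Real.log ‖x - y‖ * h y) :=
  hh.integrable_mul (Measurable.aestronglyMeasurable (by fun_prop)) x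
    (Eventually.of_forall fun y => abs_log_norm_sub_le_potWeight hs x y)

omit [BorelSpace E] in
theorem exists_integral_abs_log_mul_le (hh : PotAdmissible s s h) (hs : 0 < s) :
    ∃ C, 0 ≤ C ∧ ∀ x, ∫ y, |Real.log ‖x - y‖ * h y| ≤ C * (1 + ‖x‖) ^ s := by
  obtain ⟨C, hC0, hC⟩ := hh.exists_integral_abs_mul_le
  refine ⟨s⁻¹ * C, by positivity, fun x => ?_⟩
  rw [mul_right_comm]
  exact hC _ _ x (by positivity)
    (Eventually.of_forall fun y => abs_log_norm_sub_le_potWeight hs x y)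

theorem integrable_norm_sub_rpow_neg_mul (hh : PotAdmissible τ s h) (hτ : 0 ≤ τ) (x : E) :
    Integrable (fun y => ‖x - y‖ ^ (-s) * h y) :=
  hh.integrable_mul (c := 1) (Measurable.aestronglyMeasurable (by fun_prop)) x
    (Eventually.of_forall fun y => by
      rw [abs_of_nonneg (by positivity), one_mul]
      exact norm_sub_rpow_neg_le_potWeight hτ s x y)

omit [BorelSpace E] in
theorem exists_integral_norm_sub_rpow_neg_mul_le (hh : PotAdmissible τ s h) (hτ : 0 ≤ τ) :
    ∃ C, 0 ≤ C ∧ ∀ x, ∫ y, |‖x - y‖ ^ (-s) * h y| ≤ C := by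
  obtain ⟨C, hC0, hC⟩ := hh.exists_integral_abs_mul_le
  refine ⟨C, hC0, fun x => ?_⟩
  simpa using hC _ 1 x zero_le_one (Eventually.of_forall fun y => by
    rw [abs_of_nonneg (by positivity), one_mul]
    exact norm_sub_rpow_neg_le_potWeight hτ s x y)

end PotAdmissible

theorem HasLogGrowth.exists_abs_sub_log_one_add_le {α : ℝ} {v : Plane → ℝ}
    (hg : HasLogGrowth α v) (hv : Continuous v) :
    ∃ C, ∀ x, |v x - α * Real.log (1 + ‖x‖)| ≤ C := by
  obtain ⟨C, hC⟩ := hg.bound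
  rw [← Metric.cobounded_eq_cocompact, ← comap_norm_atTop, eventually_comap] at hC
  obtain ⟨R, hR⟩ := (hC.and (eventually_ge_atTop 1)).exists_forall_of_atTop
  have hcont : Continuous (fun x => |v x - α * Real.log (1 + ‖x‖)|) := by
    fun_prop (disch := intros; positivity)
  obtain ⟨D, hD⟩ := (isCompact_closedBall (0 : Plane) R).bddAbove_image hcont.continuousOn
  refine ⟨max D (C + |α| * Real.log 2), fun x => ?_⟩
  rcases le_total ‖x‖ R with hx | hx
  · exact (hD ⟨x, by simpa using hx, rfl⟩).trans (le_max_left _ _)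
  · refine le_trans ?_ (le_max_right _ _)
    obtain ⟨hgrowth, hx1⟩ := hR ‖x‖ hx
    have hvx : |v x - α * Real.log ‖x‖| ≤ C := by simpa using hgrowth x rfl
    calc |v x - α * Real.log (1 + ‖x‖)|
        = |(v x - α * Real.log ‖x‖) + α * (Real.log ‖x‖ - Real.log (1 + ‖x‖))| := by
          congr 1
          ring
      _ ≤ |v x - α * Real.log ‖x‖| + |α| * |Real.log ‖x‖ - Real.log (1 + ‖x‖)| := by
          rw [← abs_mul]
          exact abs_add_le _ _
      _ ≤ C + |α| * Real.log 2 := by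
          gcongr
          exact abs_log_sub_log_one_add_le hx1

/-- The logarithmic potential of a density, normalised so that its Laplacian is the density. -/
noncomputable def logPot (h : Plane → ℝ) (x : Plane) : ℝ :=
  (2 * Real.pi)⁻¹ * ∫ y, Real.log ‖x - y‖ * h y

theorem logPot_neg (h : Plane → ℝ) (x : Plane) : logPot (fun y => -h y) x = -logPot h x := by
  simp only [logPot, mul_neg, integral_neg]

theorem logPot_congr_ae {h k : Plane → ℝ} (hk : h =ᵐ[volume] k) : logPot h = logPot k := by
  ext x
  refine congrArg _ (integral_congr_ae ?_)
  filter_upwards [hk] with y hy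
  rw [hy]

namespace PotAdmissible

variable {γ s : ℝ} {h k : Plane → ℝ}

theorem logPot_add {t : ℝ} (hh : PotAdmissible s s h) (hk : PotAdmissible t t k) (hs : 0 < s)
    (ht : 0 < t) (x : Plane) : logPot (fun y => h y + k y) x = logPot h x + logPot k x := by
  simp only [logPot, mul_add]
  rw [integral_add (hh.integrable_log_mul hs x) (hk.integrable_log_mul ht x), mul_add]

theorem logPot_sub {t : ℝ} (hh : PotAdmissible s s h) (hk : PotAdmissible t t k) (hs : 0 < s)
    (ht : 0 < t) (x : Plane) : logPot (fun y => h y - k y) x = logPot h x - logPot k x := by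
  simp only [logPot, mul_sub]
  rw [integral_sub (hh.integrable_log_mul hs x) (hk.integrable_log_mul ht x), mul_sub]

theorem exists_abs_logPot_sub_logPot_le (hh : PotAdmissible s s h) (hs : 0 < s) (hs1 : s ≤ 1) :
    ∃ C, ∀ x x', |logPot h x - logPot h x'| ≤ C * ‖x - x'‖ ^ s := by
  obtain ⟨C, -, hC⟩ := hh.exists_integral_norm_sub_rpow_neg_mul_le hs.le
  refine ⟨(2 * Real.pi)⁻¹ * (s⁻¹ * (C + C)), fun x x' => ?_⟩
  have hint := fun z => (hh.integrable_norm_sub_rpow_neg_mul hs.le z).abs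
  have hker : ∀ᵐ y, ‖Real.log ‖x - y‖ * h y - Real.log ‖x' - y‖ * h y‖ ≤
      s⁻¹ * ‖x - x'‖ ^ s * (|‖x - y‖ ^ (-s) * h y| + |‖x' - y‖ ^ (-s) * h y|) := by
    filter_upwards [volume.ae_ne x, volume.ae_ne x'] with y hy hy'
    calc ‖Real.log ‖x - y‖ * h y - Real.log ‖x' - y‖ * h y‖
        = |Real.log ‖x - y‖ - Real.log ‖x' - y‖| * |h y| := by
          rw [← sub_mul, Real.norm_eq_abs, abs_mul]
      _ ≤ s⁻¹ * (‖x - x'‖ ^ s * (‖x - y‖ ^ (-s) + ‖x' - y‖ ^ (-s))) * |h y| := by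
        gcongr
        exact abs_log_norm_sub_sub_log_norm_sub_le hs hs1 hy.symm hy'.symm
      _ = _ := by
        simp only [abs_mul, abs_of_nonneg (Real.rpow_nonneg (norm_nonneg _) _)]
        ring
  have hsum : Integrable fun y =>
      s⁻¹ * ‖x - x'‖ ^ s * (|‖x - y‖ ^ (-s) * h y| + |‖x' - y‖ ^ (-s) * h y|) :=
    ((hint x).add (hint x')).const_mul _
  calc |logPot h x - logPot h x'|
      = (2 * Real.pi)⁻¹ * |∫ y, (Real.log ‖x - y‖ * h y - Real.log ‖x' - y‖ * h y)| := by
        rw [integral_sub (hh.integrable_log_mul hs x) (hh.integrable_log_mul hs x'), logPot,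
          logPot, ← mul_sub, abs_mul, abs_of_nonneg (by positivity : 0 ≤ (2 * Real.pi)⁻¹)]
    _ ≤ (2 * Real.pi)⁻¹ * ∫ y, s⁻¹ * ‖x - x'‖ ^ s *
          (|‖x - y‖ ^ (-s) * h y| + |‖x' - y‖ ^ (-s) * h y|) := by
        gcongr
        exact norm_integral_le_of_norm_le hsum hker
    _ = (2 * Real.pi)⁻¹ * (s⁻¹ * ‖x - x'‖ ^ s *
          ((∫ y, |‖x - y‖ ^ (-s) * h y|) + ∫ y, |‖x' - y‖ ^ (-s) * h y|)) := by
        rw [integral_const_mul, integral_add (hint x) (hint x')]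
    _ ≤ (2 * Real.pi)⁻¹ * (s⁻¹ * ‖x - x'‖ ^ s * (C + C)) := by
        gcongr
        exacts [hC x, hC x']
    _ = (2 * Real.pi)⁻¹ * (s⁻¹ * (C + C)) * ‖x - x'‖ ^ s := by ring

theorem continuous_logPot (hh : PotAdmissible s s h) (hs : 0 < s) (hs1 : s ≤ 1) :
    Continuous (logPot h) := by
  obtain ⟨C, hC⟩ := hh.exists_abs_logPot_sub_logPot_le hs hs1
  refine continuous_iff_continuousAt.2 fun x => ?_
  rw [ContinuousAt, tendsto_iff_dist_tendsto_zero]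
  refine squeeze_zero (fun _ => dist_nonneg) (fun y => hC y x) ?_
  have hcont : Continuous (fun y => C * ‖y - x‖ ^ s) := by fun_prop (disch := positivity)
  simpa [Real.zero_rpow hs.ne'] using hcont.tendsto x

theorem exists_abs_logPot_sub_log_le (hh : PotAdmissible (γ + s) s h) (hγ : 0 < γ) (hs : 0 < s)
    (hγs : γ + s ≤ 1) :
    ∃ C, ∀ x, x ≠ 0 →
      |logPot h x - (2 * Real.pi)⁻¹ * (∫ y, h y) * Real.log ‖x‖| ≤ C * ‖x‖ ^ (-γ) := by
  obtain ⟨C, -, hC⟩ := hh.exists_integral_abs_mul_le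
  refine ⟨(2 * Real.pi)⁻¹ * ((4 / s + 3 / γ) * C), fun x hx => ?_⟩
  have hkernel := (hh.mono (by linarith) hs.le le_rfl : PotAdmissible s s h).integrable_log_mul hs x
  have hconst := (hh.integrable (by linarith)).const_mul (Real.log ‖x‖)
  have hdiff : logPot h x - (2 * Real.pi)⁻¹ * (∫ y, h y) * Real.log ‖x‖ =
      (2 * Real.pi)⁻¹ * ∫ y, (Real.log ‖x - y‖ - Real.log ‖x‖) * h y := by
    simp_rw [sub_mul]
    rw [integral_sub hkernel hconst, integral_const_mul, logPot]
    ring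
  have hbound : ∫ y, |(Real.log ‖x - y‖ - Real.log ‖x‖) * h y| ≤
      (4 / s + 3 / γ) * ‖x‖ ^ (-γ) * C := by
    refine hC _ _ x (by positivity) ?_
    filter_upwards [volume.ae_ne x] with y hy
    exact abs_log_norm_sub_sub_log_norm_le_potWeight hγ hs hγs hx hy.symm
  calc _ = (2 * Real.pi)⁻¹ * |∫ y, (Real.log ‖x - y‖ - Real.log ‖x‖) * h y| := by
        rw [hdiff, abs_mul, abs_of_nonneg (by positivity)]
    _ ≤ (2 * Real.pi)⁻¹ * ((4 / s + 3 / γ) * ‖x‖ ^ (-γ) * C) := by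
        gcongr
        exact abs_integral_le_integral_abs.trans hbound
    _ = _ := by ring

theorem hasLogGrowth_logPot (hh : PotAdmissible (γ + s) s h) (hγ : 0 < γ) (hs : 0 < s)
    (hγs : γ + s ≤ 1) : HasLogGrowth ((2 * Real.pi)⁻¹ * ∫ y, h y) (logPot h) := by
  obtain ⟨C, hC⟩ := hh.exists_abs_logPot_sub_log_le hγ hs hγs
  refine IsBigO.of_bound |C| ?_
  filter_upwards [(tendsto_norm_cocompact_atTop (E := Plane)).eventually_ge_atTop 1] with x hx
  have hdecay : ‖x‖ ^ (-γ) ≤ 1 := Real.rpow_le_one_of_one_le_of_nonpos hx (by linarith)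
  rw [norm_one]
  calc _ ≤ C * ‖x‖ ^ (-γ) := hC x (norm_pos_iff.1 (by linarith))
    _ ≤ |C| * 1 := by
        gcongr
        exact le_abs_self C

theorem exists_abs_logPot_sub_log_one_add_le (hh : PotAdmissible (γ + s) s h) (hγ : 0 < γ)
    (hs : 0 < s) (hγs : γ + s ≤ 1) :
    ∃ C, ∀ x, |logPot h x - (2 * Real.pi)⁻¹ * (∫ y, h y) * Real.log (1 + ‖x‖)| ≤ C :=
  (hh.hasLogGrowth_logPot hγ hs hγs).exists_abs_sub_log_one_add_le
    ((hh.mono (by linarith) hs.le le_rfl : PotAdmissible s s h).continuous_logPot hs (by linarith))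

end PotAdmissible

section Admissibility

theorem rpow_interpolation_le {p A B b : ℝ} (hp : 1 < p) (hb : b < B) :
    ∃ q : ℝ, 1 < q ∧ ∀ k w : ℝ, 0 ≤ k → 1 ≤ w →
      (k * w ^ b) ^ q ≤ k * w ^ B + k ^ p * w ^ A := by
  set D := |(p - 1) * b + B - A| + 1
  set θ := (B - b) / (D + (B - b)) with hθ
  have := sub_pos.2 hb
  have hD : 0 < D := by positivity
  have hθ0 : 0 < θ := by positivity
  have hθ1 : θ < 1 := by
    rw [hθ, div_lt_one (by positivity)]
    linarith
  have hexponent : θ * ((p - 1) * b + B - A) ≤ B - b := by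
    calc θ * ((p - 1) * b + B - A) ≤ θ * D := by
          gcongr
          exact (le_abs_self _).trans (le_add_of_nonneg_right zero_le_one)
      _ ≤ B - b := by
          rw [hθ, div_mul_eq_mul_div, div_le_iff₀ (by positivity)]
          nlinarith
  refine ⟨1 + θ * (p - 1), by nlinarith, fun k w hk hw => ?_⟩
  have hw0 : 0 < w := by linarith
  have hX : 0 ≤ k * w ^ B := by positivity
  have hY : 0 ≤ k ^ p * w ^ A := by positivity
  have hk_split : k ^ (1 + θ * (p - 1)) = k ^ (1 - θ) * k ^ (p * θ) := by
    rw [← Real.rpow_add_of_nonneg hk (by linarith) (by positivity)]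
    congr 1
    ring
  have hw_split : w ^ (b * (1 + θ * (p - 1))) ≤ w ^ (B * (1 - θ)) * w ^ (A * θ) := by
    rw [← Real.rpow_add hw0]
    exact Real.rpow_le_rpow_of_exponent_le hw (by nlinarith)
  calc (k * w ^ b) ^ (1 + θ * (p - 1))
      = k ^ (1 - θ) * k ^ (p * θ) * w ^ (b * (1 + θ * (p - 1))) := by
        rw [Real.mul_rpow hk (by positivity), ← Real.rpow_mul hw0.le, hk_split]
    _ ≤ k ^ (1 - θ) * k ^ (p * θ) * (w ^ (B * (1 - θ)) * w ^ (A * θ)) := by gcongr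
    _ = (k * w ^ B) ^ (1 - θ) * (k ^ p * w ^ A) ^ θ := by
        rw [Real.mul_rpow hk (by positivity), Real.mul_rpow (by positivity) (by positivity),
          ← Real.rpow_mul hw0.le, ← Real.rpow_mul hw0.le, ← Real.rpow_mul hk]
        ring
    _ ≤ (1 - θ) * (k * w ^ B) + θ * (k ^ p * w ^ A) :=
        Real.geom_mean_le_arith_mean2_weighted (sub_nonneg.2 hθ1.le) hθ0.le hX hY (by ring)
    _ ≤ k * w ^ B + k ^ p * w ^ A := by nlinarith

variable {E : Type*} [NormedAddCommGroup E]

theorem norm_rpow_neg_inv_mul_le {q q' G : ℝ} (hqq' : q.HolderConjugate q') (hG : 0 ≤ G) (z : E) :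
    ‖z‖ ^ (-q'⁻¹) * G ≤
      G + G ^ q + (Metric.ball (0 : E) 1).indicator (fun z => ‖z‖⁻¹) z := by
  have hGq : 0 ≤ G ^ q := by positivity
  rcases lt_or_ge ‖z‖ 1 with hz | hz
  · rw [Set.indicator_of_mem (by simpa using hz)]
    calc ‖z‖ ^ (-q'⁻¹) * G ≤ (‖z‖ ^ (-q'⁻¹)) ^ q' / q' + G ^ q / q :=
          Real.young_inequality_of_nonneg (by positivity) hG hqq'.symm
      _ = ‖z‖⁻¹ / q' + G ^ q / q := by
          rw [← Real.rpow_mul (norm_nonneg _), neg_mul, inv_mul_cancel₀ hqq'.symm.pos.ne',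
            Real.rpow_neg_one]
      _ ≤ ‖z‖⁻¹ + G ^ q := add_le_add (div_le_self (by positivity) hqq'.symm.lt.le)
          (div_le_self hGq hqq'.lt.le)
      _ ≤ G + G ^ q + ‖z‖⁻¹ := by linarith
  · rw [Set.indicator_of_notMem (by simpa using hz), add_zero]
    have hle_one : ‖z‖ ^ (-q'⁻¹) ≤ 1 :=
      Real.rpow_le_one_of_one_le_of_nonpos hz (by simp [hqq'.symm.pos.le])
    nlinarith

theorem potWeight_mul_le {q q' B κ τ k C : ℝ} (hqq' : q.HolderConjugate q') (hb : κ + τ ≤ B)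
    (hk : 0 ≤ k) (x y : E) (hC : (k * (1 + ‖y‖) ^ (κ + τ)) ^ q ≤ C) :
    potWeight τ q'⁻¹ x y * (k * (1 + ‖y‖) ^ κ) ≤
      2 * (k * (1 + ‖y‖) ^ B) + C +
        (Metric.ball (0 : E) 1).indicator (fun z => ‖z‖⁻¹) (x - y) := by
  set G := k * (1 + ‖y‖) ^ (κ + τ) with hG
  have hGB : G ≤ k * (1 + ‖y‖) ^ B := by
    rw [hG]
    gcongr
    linarith [norm_nonneg y]
  have hsing := norm_rpow_neg_inv_mul_le hqq' (show 0 ≤ G by positivity) (x - y)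
  calc potWeight τ q'⁻¹ x y * (k * (1 + ‖y‖) ^ κ) = G + ‖x - y‖ ^ (-q'⁻¹) * G := by
        rw [potWeight, hG, Real.rpow_add (by positivity)]
        ring
    _ ≤ _ := by linarith

theorem PotAdmissible.of_le_add_comp_sub [MeasureSpace E] [BorelSpace E]
    [(volume : Measure E).IsAddLeftInvariant] [(volume : Measure E).IsNegInvariant] {τ s : ℝ}
    {h F k : E → ℝ}
    (hh : AEStronglyMeasurable h volume) (hF : Integrable F) (hk : Integrable k)
    (hle : ∀ x y, potWeight τ s x y * |h y| ≤ F y + k (x - y)) : PotAdmissible τ s h := by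
  refine ⟨hh, (∫ y, F y) + ∫ z, k z, fun x => ?_⟩
  have hkx : Integrable (fun y => k (x - y)) := hk.comp_sub_left x
  have hint : Integrable (fun y => potWeight τ s x y * |h y|) := by
    refine (hF.add hkx).mono' ((measurable_potWeight τ s x).aestronglyMeasurable.mul hh.norm)
      (Eventually.of_forall fun y => ?_)
    rw [Real.norm_of_nonneg (mul_nonneg (potWeight_nonneg _ _ _ _) (abs_nonneg _))]
    exact hle x y
  refine ⟨hint, (integral_mono hint (hF.add hkx) (hle x)).trans (le_of_eq ?_)⟩
  exact (integral_add hF hkx).trans (by rw [integral_sub_left_eq_self k volume x])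

theorem integrable_indicator_ball_norm_inv :
    Integrable ((Metric.ball (0 : Plane) 1).indicator fun z => ‖z‖⁻¹) := by
  refine (integrable_indicator_iff Metric.isOpen_ball.measurableSet).2 ?_
  refine integrableOn_ball_of_norm_le_rpow (C := 1) (α := 1) (by simp) (by simp)
    (Eventually.of_forall fun z => ?_) (Measurable.aestronglyMeasurable (by fun_prop))
  simp [Real.rpow_neg_one]

theorem exists_potAdmissible_abs_mul_rpow {K : Plane → ℝ} (hK : AEMeasurable K volume)
    {p A B κ τ : ℝ} (hp : 1 < p) (hKB : Integrable (fun x => |K x| * (1 + ‖x‖) ^ B))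
    (hKA : Integrable (fun x => |K x| ^ p * (1 + ‖x‖) ^ A)) (hb : κ + τ < B) :
    ∃ s₀, 0 < s₀ ∧ ∀ s, 0 ≤ s → s ≤ s₀ →
      PotAdmissible τ s (fun y => |K y| * (1 + ‖y‖) ^ κ) := by
  obtain ⟨q, hq, hinterp⟩ := rpow_interpolation_le (A := A) hp hb
  have hqq' := Real.HolderConjugate.conjExponent hq
  refine ⟨q.conjExponent⁻¹, inv_pos.2 hqq'.symm.pos, fun s hs hs' =>
    PotAdmissible.mono (s := q.conjExponent⁻¹) ?_ le_rfl hs hs'⟩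
  refine .of_le_add_comp_sub
    (hK.aestronglyMeasurable.norm.mul (Measurable.aestronglyMeasurable (by fun_prop)))
    ((hKB.const_mul 2).add (hKB.add hKA)) integrable_indicator_ball_norm_inv fun x y => ?_
  rw [abs_of_nonneg (by positivity)]
  exact potWeight_mul_le hqq' hb.le (abs_nonneg _) x y
    (hinterp |K y| (1 + ‖y‖) (abs_nonneg _) (by linarith [norm_nonneg y]))

end Admissibility

section CircleMeans

/-- The standard isometry between `ℂ` and the plane, through which circle averages in `ℂ` are
transported. -/
noncomputable def planeIso : ℂ ≃ₗᵢ[ℝ] Plane := Complex.orthonormalBasisOneI.repr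

/-- The mean of `f` over the circle of centre `x` and radius `r`. -/
noncomputable def circMean (f : Plane → ℝ) (x : Plane) (r : ℝ) : ℝ :=
  Real.circleAverage (fun z => f (planeIso z)) (planeIso.symm x) r

/-- The parametrisation by the angle of the circle of centre `x` and radius `r`. -/
noncomputable def circPath (x : Plane) (r θ : ℝ) : Plane :=
  planeIso (circleMap (planeIso.symm x) r θ)

@[fun_prop]
theorem continuous_circPath (x : Plane) (r : ℝ) : Continuous (circPath x r) :=
  planeIso.continuous.comp (continuous_circleMap _ r)

theorem exists_circPath_eq {x z : Plane} {r : ℝ} (hz : ‖z - x‖ = |r|) :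
    ∃ θ ∈ Set.Ioc 0 (2 * Real.pi), circPath x r θ = z := by
  have hmem : planeIso.symm z ∈ Metric.sphere (planeIso.symm x) |r| := by
    rw [mem_sphere_iff_norm, ← map_sub, planeIso.symm.norm_map, hz]
  rw [← image_circleMap_Ioc] at hmem
  obtain ⟨θ, hθ, hθz⟩ := hmem
  exact ⟨θ, hθ, by rw [circPath, hθz, planeIso.apply_symm_apply]⟩

theorem circMean_eq_integral (f : Plane → ℝ) (x : Plane) (r : ℝ) :
    circMean f x r = (2 * Real.pi)⁻¹ * ∫ θ in Set.Ioc 0 (2 * Real.pi), f (circPath x r θ) := by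
  rw [circMean, Real.circleAverage, intervalIntegral.integral_of_le Real.two_pi_pos.le,
    smul_eq_mul]
  rfl

theorem log_add_posLog_inv_mul {r d : ℝ} (hr : 0 < r) (hd : 0 ≤ d) :
    Real.log r + Real.posLog (r⁻¹ * d) = Real.log (max r d) := by
  rw [Real.posLog_eq_log_max_one (by positivity), ← Real.log_mul hr.ne' (by positivity),
    mul_max_of_nonneg _ _ hr.le, mul_one, mul_inv_cancel_left₀ hr.ne']

theorem circMean_log_norm_sub (x y : Plane) {r : ℝ} (hr : 0 < r) :
    circMean (fun z => Real.log ‖z - y‖) x r = Real.log (max r ‖x - y‖) := by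
  have hcirc := circleAverage_log_norm_sub_const_eq_log_radius_add_posLog
    (a := planeIso.symm y) (c := planeIso.symm x) hr.ne'
  rw [← map_sub, planeIso.symm.norm_map, log_add_posLog_inv_mul hr (norm_nonneg _)] at hcirc
  rw [← hcirc, circMean]
  congr 1
  ext z
  rw [← planeIso.norm_map (z - _), map_sub, planeIso.apply_symm_apply]

end CircleMeans

theorem PotAdmissible.integrable_prod_mul_log_mul {E T : Type*} [NormedAddCommGroup E]
    [MeasureSpace E] [BorelSpace E] [SecondCountableTopology E] [SFinite (volume : Measure E)]
    [MeasurableSpace T] {μ : Measure T} {s : ℝ} {h : E → ℝ}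
    (hh : PotAdmissible s s h) (hs : 0 < s) {c : T → E} (hc : Measurable c) {w : T → ℝ}
    (hw : Integrable (fun t => (1 + ‖c t‖) ^ s * w t) μ) :
    Integrable (fun p : T × E => w p.1 * (Real.log ‖c p.1 - p.2‖ * h p.2)) (μ.prod volume) := by
  obtain ⟨C, -, hC⟩ := hh.exists_integral_abs_log_mul_le hs
  have hw_meas : AEStronglyMeasurable w μ := by
    have hquot := (Measurable.aestronglyMeasurable (μ := μ)
      (by fun_prop : Measurable fun t => ((1 + ‖c t‖) ^ s)⁻¹)).mul hw.aestronglyMeasurable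
    refine hquot.congr (Eventually.of_forall fun t => inv_mul_cancel_left₀ ?_ _)
    positivity
  have hmeas : AEStronglyMeasurable (fun p : T × E => w p.1 * (Real.log ‖c p.1 - p.2‖ * h p.2))
      (μ.prod volume) :=
    hw_meas.comp_fst.mul
      ((Measurable.aestronglyMeasurable (by fun_prop)).mul hh.aestronglyMeasurable.comp_snd)
  rw [integrable_prod_iff hmeas]
  refine ⟨Eventually.of_forall fun t => (hh.integrable_log_mul hs (c t)).const_mul (w t),
    (hw.norm.const_mul C).mono' hmeas.norm.integral_prod_right' (Eventually.of_forall fun t => ?_)⟩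
  calc ‖∫ y, ‖w t * (Real.log ‖c t - y‖ * h y)‖‖
      = |w t| * ∫ y, |Real.log ‖c t - y‖ * h y| := by
        rw [Real.norm_of_nonneg (integral_nonneg fun _ => norm_nonneg _), ← integral_const_mul]
        exact integral_congr_ae (Eventually.of_forall fun y => norm_mul _ _)
    _ ≤ |w t| * (C * (1 + ‖c t‖) ^ s) := by
        gcongr
        exact hC (c t)
    _ = C * ‖(1 + ‖c t‖) ^ s * w t‖ := by
        rw [norm_mul, Real.norm_of_nonneg (by positivity), Real.norm_eq_abs]
        ring

section CircleMeansOfPotentials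

variable {s : ℝ} {h : Plane → ℝ} {x : Plane} {r : ℝ}

theorem integral_circPath_log_norm_sub (x y : Plane) (hr : 0 < r) :
    ∫ θ in Set.Ioc 0 (2 * Real.pi), Real.log ‖circPath x r θ - y‖ =
      2 * Real.pi * Real.log (max r ‖x - y‖) := by
  rw [← circMean_log_norm_sub x y hr, circMean_eq_integral,
    mul_inv_cancel_left₀ Real.two_pi_pos.ne']

theorem integrable_prod_log_circPath_mul (hh : PotAdmissible s s h) (hs : 0 < s) (x : Plane)
    (r : ℝ) :
    Integrable (fun p : ℝ × Plane => Real.log ‖circPath x r p.1 - p.2‖ * h p.2)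
      ((volume.restrict (Set.Ioc 0 (2 * Real.pi))).prod volume) := by
  have hcont : Continuous (fun θ => (1 + ‖circPath x r θ‖) ^ s * 1) := by
    fun_prop (disch := positivity)
  simpa using hh.integrable_prod_mul_log_mul hs (continuous_circPath x r).measurable
    (hcont.integrableOn_Ioc (μ := volume) (a := 0) (b := 2 * Real.pi))

theorem integrable_log_max_mul (hh : PotAdmissible s s h) (hs : 0 < s) (x : Plane) (hr : 0 < r) :
    Integrable (fun y => Real.log (max r ‖x - y‖) * h y) := by
  refine ((integrable_prod_log_circPath_mul hh hs x r).integral_prod_right.const_mul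
    (2 * Real.pi)⁻¹).congr (Eventually.of_forall fun y => ?_)
  simp only [integral_mul_const, integral_circPath_log_norm_sub x _ hr]
  rw [mul_assoc, inv_mul_cancel_left₀ Real.two_pi_pos.ne']

theorem circMean_logPot (hh : PotAdmissible s s h) (hs : 0 < s) (x : Plane) (hr : 0 < r) :
    circMean (logPot h) x r = (2 * Real.pi)⁻¹ * ∫ y, Real.log (max r ‖x - y‖) * h y := by
  have hswap := integral_integral_swap (f := fun θ y => Real.log ‖circPath x r θ - y‖ * h y)
    (integrable_prod_log_circPath_mul hh hs x r)
  simp only [integral_mul_const, integral_circPath_log_norm_sub x _ hr] at hswap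
  simp_rw [mul_assoc (2 * Real.pi)] at hswap
  rw [integral_const_mul] at hswap
  simp only [circMean_eq_integral, logPot]
  rw [integral_const_mul, hswap, inv_mul_cancel_left₀ Real.two_pi_pos.ne']

theorem logPot_le_circMean (hh : PotAdmissible s s h) (hs : 0 < s) (hr : 0 < r)
    (hpos : ∀ᵐ y, y ∈ Metric.closedBall x r → 0 ≤ h y) : logPot h x ≤ circMean (logPot h) x r := by
  rw [circMean_logPot hh hs x hr, logPot]
  refine mul_le_mul_of_nonneg_left (integral_mono_ae (hh.integrable_log_mul hs x)
    (integrable_log_max_mul hh hs x hr) ?_) (by positivity)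
  filter_upwards [hpos, volume.ae_ne x] with y hy hyx
  have hxy : 0 < ‖x - y‖ := norm_pos_iff.2 (sub_ne_zero.2 hyx.symm)
  rcases le_total r ‖x - y‖ with hfar | hnear
  · rw [max_eq_right hfar]
  · exact mul_le_mul_of_nonneg_right (Real.log_le_log hxy (le_max_right _ _))
      (hy (by rwa [Metric.mem_closedBall, dist_comm, dist_eq_norm]))

theorem circMean_logPot_nonneg (hh : PotAdmissible s s h) (hint : Integrable h) (hs : 0 < s)
    (hr : 0 < r) (h0 : ∫ y, h y = 0) (hpos : ∀ᵐ y, r ≤ ‖x - y‖ → 0 ≤ h y) :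
    0 ≤ circMean (logPot h) x r := by
  have hsub : ∫ y, Real.log (max r ‖x - y‖) * h y =
      ∫ y, (Real.log (max r ‖x - y‖) - Real.log r) * h y := by
    simp only [sub_mul]
    rw [integral_sub (integrable_log_max_mul hh hs x hr) (hint.const_mul _), integral_const_mul,
      h0, mul_zero, sub_zero]
  rw [circMean_logPot hh hs x hr, hsub]
  refine mul_nonneg (by positivity) (integral_nonneg_of_ae ?_)
  filter_upwards [hpos] with y hy
  rcases le_total r ‖x - y‖ with hfar | hnear
  · exact mul_nonneg (sub_nonneg.2 (Real.log_le_log hr (le_max_left _ _))) (hy hfar)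
  · simp [max_eq_left hnear]

end CircleMeansOfPotentials

section MaximumPrinciple

theorem eq_of_le_circMean {f : Plane → ℝ} (hf : Continuous f) {M : ℝ} (hM : ∀ x, f x ≤ M)
    {x : Plane} {r : ℝ} (h : M ≤ circMean f x r) {z : Plane} (hz : ‖z - x‖ = |r|) : f z = M := by
  by_contra hne
  obtain ⟨θ, hθ, hθz⟩ := exists_circPath_eq hz
  have hcont : Continuous fun θ => f (circPath x r θ) := by fun_prop
  have hpos : 0 < ∫ θ in (0:ℝ)..2 * Real.pi, (M - f (circPath x r θ)) := by
    refine intervalIntegral.integral_pos Real.two_pi_pos (by fun_prop)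
      (fun θ _ => sub_nonneg.2 (hM _)) ⟨θ, Set.Ioc_subset_Icc_self hθ, ?_⟩
    rw [hθz]
    exact sub_pos.2 (lt_of_le_of_ne (hM z) hne)
  rw [intervalIntegral.integral_sub (by simp) (hcont.intervalIntegrable _ _),
    intervalIntegral.integral_const, sub_zero, smul_eq_mul,
    intervalIntegral.integral_of_le Real.two_pi_pos.le] at hpos
  rw [circMean_eq_integral, le_inv_mul_iff₀ Real.two_pi_pos] at h
  linarith

theorem eq_of_eventually_le_circMean {f : Plane → ℝ} (hf : Continuous f) {x₀ : Plane}
    (hmax : ∀ x, f x ≤ f x₀)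
    (hmean : ∀ x, f x = f x₀ → ∃ δ > 0, ∀ r, 0 < r → r < δ → f x ≤ circMean f x r) (x : Plane) :
    f x = f x₀ := by
  have hclopen : IsClopen {x | f x = f x₀} := by
    refine ⟨isClosed_eq hf continuous_const, Metric.isOpen_iff.2 fun x (hx : f x = f x₀) => ?_⟩
    obtain ⟨δ, hδ, hle⟩ := hmean x hx
    refine ⟨δ, hδ, fun z hz => ?_⟩
    rcases eq_or_ne z x with rfl | hzx
    · exact hx
    · have hr : 0 < ‖z - x‖ := norm_pos_iff.2 (sub_ne_zero.2 hzx)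
      exact eq_of_le_circMean hf hmax (hx ▸ hle _ hr (by simpa [dist_eq_norm] using hz))
        (abs_of_pos hr).symm
  exact Set.eq_univ_iff_forall.1 (hclopen.eq_univ ⟨x₀, rfl⟩) x

variable {γ s : ℝ} {h : Plane → ℝ}

theorem tendsto_logPot_of_integral_eq_zero (hh : PotAdmissible (γ + s) s h) (hγ : 0 < γ)
    (hs : 0 < s) (hγs : γ + s ≤ 1) (h0 : ∫ y, h y = 0) :
    Tendsto (logPot h) (cocompact Plane) (nhds 0) := by
  obtain ⟨C, hC⟩ := hh.exists_abs_logPot_sub_log_le hγ hs hγs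
  have hbound : Tendsto (fun x : Plane => C * ‖x‖ ^ (-γ)) (cocompact Plane) (nhds 0) := by
    simpa using ((tendsto_rpow_neg_atTop hγ).comp tendsto_norm_cocompact_atTop).const_mul C
  refine squeeze_zero_norm' ?_ hbound
  filter_upwards [(isCompact_singleton (x := (0 : Plane))).compl_mem_cocompact] with x hx
  simpa [h0] using hC x hx

theorem exists_forall_logPot_le (hh : PotAdmissible (γ + s) s h) (hγ : 0 < γ) (hs : 0 < s)
    (hγs : γ + s ≤ 1) (h0 : ∫ y, h y = 0) {B : ℝ} (hpos : ∀ᵐ y, B < logPot h y → 0 ≤ h y)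
    (hB : ∃ x, B < logPot h x) : ∃ x, ∀ y, logPot h y ≤ logPot h x := by
  have hh' := hh.mono (show s ≤ γ + s by linarith) hs.le le_rfl
  have hcont : Continuous (logPot h) := hh'.continuous_logPot hs (by linarith)
  have hlim := tendsto_logPot_of_integral_eq_zero hh hγ hs hγs h0
  by_cases hex : ∃ x, 0 < logPot h x
  · obtain ⟨x, hx⟩ := hex
    exact hcont.exists_forall_ge' x ((hlim.eventually (gt_mem_nhds hx)).mono fun y hy => hy.le)
  push Not at hex
  obtain ⟨x, hx⟩ := hB
  -- `h` is nonnegative far away, so the mean of `logPot h` over a large circle is nonnegative.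
  have hfar := hlim.eventually (lt_mem_nhds (hx.trans_le (hex x)))
  rw [← Metric.cobounded_eq_cocompact, ← comap_norm_atTop, eventually_comap] at hfar
  obtain ⟨R, hR⟩ := (hfar.and (eventually_gt_atTop 0)).exists_forall_of_atTop
  have hR0 : 0 < R := (hR R le_rfl).2
  have hmean : 0 ≤ circMean (logPot h) 0 R := by
    refine circMean_logPot_nonneg hh' (hh.integrable (by linarith)) hs hR0 h0 ?_
    filter_upwards [hpos] with y hy hRy
    exact hy ((hR ‖y‖ (by simpa using hRy)).1 y rfl)
  refine ⟨planeIso R, fun y => (hex y).trans_eq ?_⟩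
  exact (eq_of_le_circMean hcont hex hmean (by simp)).symm

theorem logPot_le_or_ae_eq_zero (hh : PotAdmissible (γ + s) s h) (hγ : 0 < γ) (hs : 0 < s)
    (hγs : γ + s ≤ 1) (h0 : ∫ y, h y = 0) {B : ℝ} (hpos : ∀ᵐ y, B < logPot h y → 0 ≤ h y) :
    (∀ x, logPot h x ≤ B) ∨ h =ᵐ[volume] 0 := by
  refine or_iff_not_imp_left.2 fun hB => ?_
  push Not at hB
  obtain ⟨x₀, hx₀⟩ := exists_forall_logPot_le hh hγ hs hγs h0 hpos hB
  obtain ⟨x₁, hx₁⟩ := hB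
  have hh' := hh.mono (show s ≤ γ + s by linarith) hs.le le_rfl
  have hcont : Continuous (logPot h) := hh'.continuous_logPot hs (by linarith)
  have hBx₀ : B < logPot h x₀ := hx₁.trans_le (hx₀ x₁)
  have hconst : ∀ x, logPot h x = logPot h x₀ := by
    refine eq_of_eventually_le_circMean hcont hx₀ fun x hx => ?_
    obtain ⟨δ, hδ, hball⟩ := Metric.eventually_nhds_iff_ball.1
      (hcont.continuousAt.eventually (lt_mem_nhds (hx.symm ▸ hBx₀ : B < logPot h x)))
    refine ⟨δ, hδ, fun r hr hrδ => logPot_le_circMean hh' hs hr ?_⟩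
    filter_upwards [hpos] with y hy hyr
    exact hy (hball y (Metric.closedBall_subset_ball hrδ hyr))
  have hnonneg : 0 ≤ᵐ[volume] h := hpos.mono fun y hy => hy (hBx₀.trans_eq (hconst y).symm)
  exact (integral_eq_zero_iff_of_nonneg_ae hnonneg (hh.integrable (by linarith))).1 h0

end MaximumPrinciple

section Laplacian

theorem contDiff_fderiv_apply_const {E : Type*} [NormedAddCommGroup E] [NormedSpace ℝ E]
    {f : E → ℝ} (hf : ContDiff ℝ ∞ f) (v : E) : ContDiff ℝ ∞ (fun z => fderiv ℝ f z v) :=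
  (hf.fderiv_right (m := ∞) (by simp)).clm_apply contDiff_const

variable {E : Type*} [NormedAddCommGroup E] [InnerProductSpace ℝ E] [FiniteDimensional ℝ E]
  {f g : E → ℝ}

theorem laplacian_eq_sum_fderiv {ι : Type*} [Fintype ι] (b : OrthonormalBasis ι ℝ E)
    (hf : ContDiff ℝ 2 f) (x : E) :
    Laplacian.laplacian f x = ∑ i, fderiv ℝ (fun z => fderiv ℝ f z (b i)) x (b i) := by
  rw [InnerProductSpace.laplacian_eq_iteratedFDeriv_orthonormalBasis f b]
  refine Finset.sum_congr rfl fun i _ => ?_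
  have hd : DifferentiableAt ℝ (fderiv ℝ f) x :=
    (hf.fderiv_right (m := 1) (by norm_num)).differentiable one_ne_zero x
  rw [iteratedFDeriv_two_apply, fderiv_clm_apply hd (by fun_prop)]
  simp

theorem continuous_laplacian (hf : ContDiff ℝ ∞ f) : Continuous (Laplacian.laplacian f) := by
  rw [funext (laplacian_eq_sum_fderiv (stdOrthonormalBasis ℝ E) (hf.of_le ENat.LEInfty.out))]
  exact continuous_finsetSum _ fun i _ =>
    (contDiff_fderiv_apply_const (contDiff_fderiv_apply_const hf _) _).continuous

theorem hasCompactSupport_laplacian (hc : HasCompactSupport f) :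
    HasCompactSupport (Laplacian.laplacian f) := by
  refine HasCompactSupport.intro' hc (isClosed_tsupport f) fun x hx => ?_
  have hzero : f =ᶠ[nhds x] fun _ => 0 := notMem_tsupport_iff_eventuallyEq.1 hx
  exact (InnerProductSpace.laplacian_congr_nhds hzero).eq_of_nhds.trans (by simp)

theorem laplacian_comp_add_right (hf : ContDiff ℝ ∞ f) (a x : E) :
    Laplacian.laplacian (fun z => f (z + a)) x = Laplacian.laplacian f (x + a) := by
  have hf_shift : ContDiff ℝ ∞ (fun z => f (z + a)) := hf.comp (contDiff_id.add contDiff_const)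
  rw [laplacian_eq_sum_fderiv (stdOrthonormalBasis ℝ E) (hf_shift.of_le ENat.LEInfty.out),
    laplacian_eq_sum_fderiv (stdOrthonormalBasis ℝ E) (hf.of_le ENat.LEInfty.out)]
  refine Finset.sum_congr rfl fun i _ => ?_
  simp_rw [fderiv_comp_add_right]
  rw [fderiv_comp_add_right (f := fun z => fderiv ℝ f z (stdOrthonormalBasis ℝ E i))]

variable [MeasurableSpace E] [BorelSpace E]

theorem integral_mul_fderiv_apply (hf : ContDiff ℝ ∞ f) (hg : ContDiff ℝ ∞ g)
    (hfg : HasCompactSupport f ∨ HasCompactSupport g) (v : E) :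
    ∫ x, f x * fderiv ℝ g x v = -∫ x, fderiv ℝ f x v * g x := by
  have hint : ∀ {a b : E → ℝ}, ContDiff ℝ ∞ a → ContDiff ℝ ∞ b →
      HasCompactSupport a ∨ HasCompactSupport b → Integrable (fun x => a x * b x) :=
    fun ha hb hab => (ha.continuous.mul hb.continuous).integrable_of_hasCompactSupport
      (hab.elim (·.mul_right) (·.mul_left))
  have hf' := contDiff_fderiv_apply_const hf v
  have hg' := contDiff_fderiv_apply_const hg v
  exact integral_mul_fderiv_eq_neg_fderiv_mul_of_integrable
    (hint hf' hg (hfg.imp_left fun h => h.fderiv_apply ℝ v))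
    (hint hf hg' (hfg.imp_right fun h => h.fderiv_apply ℝ v)) (hint hf hg hfg)
    (fun x _ => hf.differentiable (by simp) x) (fun x _ => hg.differentiable (by simp) x)

theorem integral_mul_laplacian (hf : ContDiff ℝ ∞ f) (hg : ContDiff ℝ ∞ g)
    (hc : HasCompactSupport g) :
    ∫ x, f x * Laplacian.laplacian g x = ∫ x, Laplacian.laplacian f x * g x := by
  set b := stdOrthonormalBasis ℝ E
  have hf' := fun i => contDiff_fderiv_apply_const hf (b i)
  have hg' := fun i => contDiff_fderiv_apply_const hg (b i)
  have hc' := fun i => hc.fderiv_apply ℝ (b i)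
  simp_rw [laplacian_eq_sum_fderiv b (hg.of_le ENat.LEInfty.out),
    laplacian_eq_sum_fderiv b (hf.of_le ENat.LEInfty.out), Finset.mul_sum, Finset.sum_mul]
  rw [integral_finsetSum, integral_finsetSum]
  · refine Finset.sum_congr rfl fun i _ => ?_
    rw [integral_mul_fderiv_apply hf (hg' i) (.inr (hc' i)),
      integral_mul_fderiv_apply (hf' i) hg (.inr hc), neg_neg]
  · exact fun i _ => ((contDiff_fderiv_apply_const (hf' i) _).continuous.mul
      hg.continuous).integrable_of_hasCompactSupport hc.mul_left
  · exact fun i _ => (hf.continuous.mul (contDiff_fderiv_apply_const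
      (hg' i) _).continuous).integrable_of_hasCompactSupport ((hc' i).fderiv_apply ℝ (b i)).mul_left

end Laplacian

section FundamentalSolution

/-- The regularisation `log √(‖x‖² + ε²)` of `log ‖x‖`. -/
noncomputable def smoothLog (ε : ℝ) (x : Plane) : ℝ := 2⁻¹ * Real.log (‖x‖ ^ 2 + ε ^ 2)

variable {ε : ℝ} {x : Plane} {φ : Plane → ℝ}

theorem contDiff_smoothLog (hε : 0 < ε) : ContDiff ℝ ∞ (smoothLog ε) :=
  contDiff_const.mul (((contDiff_norm_sq ℝ).add contDiff_const).log fun x => by positivity)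

theorem log_norm_le_smoothLog (ε : ℝ) (hx : x ≠ 0) : Real.log ‖x‖ ≤ smoothLog ε x := by
  have := norm_pos_iff.2 hx
  have hlog := Real.log_le_log (by positivity) (le_add_of_nonneg_right (sq_nonneg ε) :
    ‖x‖ ^ 2 ≤ ‖x‖ ^ 2 + ε ^ 2)
  rw [Real.log_pow, Nat.cast_ofNat] at hlog
  rw [smoothLog]
  linarith

theorem smoothLog_le_smoothLog {δ : ℝ} (hε : 0 < ε) (hεδ : ε ≤ δ) (x : Plane) :
    smoothLog ε x ≤ smoothLog δ x := by
  unfold smoothLog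
  gcongr

theorem tendsto_smoothLog (hx : x ≠ 0) :
    Tendsto (fun ε => smoothLog ε x) (nhds 0) (nhds (Real.log ‖x‖)) := by
  have := norm_pos_iff.2 hx
  have hcont : ContinuousAt (fun ε => smoothLog ε x) 0 := by
    unfold smoothLog
    fun_prop (disch := positivity)
  convert hcont.tendsto using 2
  simp [smoothLog, Real.log_pow]

theorem fderiv_smoothLog_apply (hε : 0 < ε) (z w : Plane) :
    fderiv ℝ (smoothLog ε) z w = inner ℝ z w * (‖z‖ ^ 2 + ε ^ 2)⁻¹ := by
  have hderiv : HasFDerivAt (smoothLog ε) _ z :=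
    (((hasStrictFDerivAt_norm_sq z).hasFDerivAt.add_const (ε ^ 2)).log
      (by positivity)).const_mul 2⁻¹
  rw [hderiv.fderiv]
  simp
  ring

theorem fderiv_fderiv_smoothLog_apply (hε : 0 < ε) (x w : Plane) :
    fderiv ℝ (fun z => fderiv ℝ (smoothLog ε) z w) x w =
      ‖w‖ ^ 2 * (‖x‖ ^ 2 + ε ^ 2)⁻¹ - 2 * (inner ℝ x w) ^ 2 * ((‖x‖ ^ 2 + ε ^ 2) ^ 2)⁻¹ := by
  simp_rw [fderiv_smoothLog_apply hε]
  have hinner : HasFDerivAt (fun z : Plane => inner ℝ z w) (innerSL ℝ w) x := by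
    simp_rw [real_inner_comm]
    exact (innerSL ℝ w).hasFDerivAt
  have hinv := (hasDerivAt_inv (by positivity : ‖x‖ ^ 2 + ε ^ 2 ≠ 0)).comp_hasFDerivAt x
    ((hasStrictFDerivAt_norm_sq x).hasFDerivAt.add_const (ε ^ 2))
  have hderiv : HasFDerivAt (fun z : Plane => inner ℝ z w * (‖z‖ ^ 2 + ε ^ 2)⁻¹) _ x :=
    hinner.mul hinv
  rw [hderiv.fderiv]
  simp
  ring

theorem laplacian_smoothLog (hε : 0 < ε) (x : Plane) :
    Laplacian.laplacian (smoothLog ε) x = 2 * ε ^ 2 / (‖x‖ ^ 2 + ε ^ 2) ^ 2 := by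
  set b := EuclideanSpace.basisFun (Fin 2) ℝ
  rw [laplacian_eq_sum_fderiv b ((contDiff_smoothLog hε).of_le ENat.LEInfty.out)]
  simp_rw [fderiv_fderiv_smoothLog_apply hε]
  rw [Finset.sum_sub_distrib, ← Finset.sum_mul, ← Finset.sum_mul, ← Finset.mul_sum,
    b.sum_sq_inner_left]
  simp only [b.norm_eq_one, one_pow, Finset.sum_const, Finset.card_univ, Fintype.card_fin]
  field_simp
  ring

theorem integrable_and_integral_inv_one_add_sq_sq :
    Integrable (fun z : Plane => 2 / (1 + ‖z‖ ^ 2) ^ 2) ∧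
      ∫ z : Plane, 2 / (1 + ‖z‖ ^ 2) ^ 2 = 2 * Real.pi := by
  have hderiv : ∀ r ∈ Set.Ici (0 : ℝ), HasDerivAt (fun r : ℝ => -(1 + r ^ 2)⁻¹)
      (r * (2 / (1 + r ^ 2) ^ 2)) r := fun r _ => by
    have hne : (1 + r ^ 2) ≠ 0 := by positivity
    refine (((hasDerivAt_pow 2 r).const_add 1).inv hne).neg.congr_deriv ?_
    simp
    field_simp
  have hnonneg : ∀ r ∈ Set.Ioi (0 : ℝ), 0 ≤ r * (2 / (1 + r ^ 2) ^ 2) := fun r hr => by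
    have := Set.mem_Ioi.1 hr
    positivity
  have hlim : Tendsto (fun r : ℝ => -(1 + r ^ 2)⁻¹) atTop (nhds 0) := by
    have : Tendsto (fun r : ℝ => 1 + r ^ 2) atTop atTop :=
      tendsto_atTop_add_const_left _ _ (tendsto_pow_atTop two_ne_zero)
    simpa using this.inv_tendsto_atTop.neg
  constructor
  · rw [integrable_fun_norm_addHaar (μ := (volume : Measure Plane))
      (f := fun r : ℝ => 2 / (1 + r ^ 2) ^ 2)]
    simpa using integrableOn_Ioi_deriv_of_nonneg' hderiv hnonneg hlim
  · have hball : (volume : Measure Plane).real (Metric.ball 0 1) = Real.pi := by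
      rw [Measure.real, EuclideanSpace.volume_ball_fin_two]
      simp [Real.pi_pos.le]
    rw [integral_fun_norm_addHaar (volume : Measure Plane) (fun r : ℝ => 2 / (1 + r ^ 2) ^ 2),
      hball]
    simp only [finrank_euclideanSpace, Fintype.card_fin, Nat.add_one_sub_one, pow_one, smul_eq_mul,
      integral_Ioi_of_hasDerivAt_of_nonneg' hderiv hnonneg hlim]
    simp

theorem integral_smoothLog_mul_laplacian (hφ : ContDiff ℝ ∞ φ) (hc : HasCompactSupport φ)
    (hε : 0 < ε) :
    ∫ x, smoothLog ε x * Laplacian.laplacian φ x =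
      ∫ z : Plane, 2 / (1 + ‖z‖ ^ 2) ^ 2 * φ (ε • z) := by
  rw [integral_mul_laplacian (contDiff_smoothLog hε) hφ hc]
  simp_rw [laplacian_smoothLog hε]
  have hscale := Measure.integral_comp_smul (volume : Measure Plane)
    (fun x => 2 * ε ^ 2 / (‖x‖ ^ 2 + ε ^ 2) ^ 2 * φ x) ε
  rw [finrank_euclideanSpace, Fintype.card_fin, abs_of_pos (by positivity), smul_eq_mul,
    eq_inv_mul_iff_mul_eq₀ (by positivity), ← integral_const_mul] at hscale
  rw [← hscale]
  congr 1
  ext z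
  rw [norm_smul, Real.norm_of_nonneg hε.le]
  have : (ε * ‖z‖) ^ 2 + ε ^ 2 = ε ^ 2 * (1 + ‖z‖ ^ 2) := by ring
  rw [this]
  field_simp

theorem exists_potAdmissible_of_hasCompactSupport {g : Plane → ℝ} (hg : Continuous g)
    (hc : HasCompactSupport g) : ∃ s, 0 < s ∧ s ≤ 1 ∧ PotAdmissible s s g := by
  have hint_growth : Integrable (fun x => |g x| * (1 + ‖x‖) ^ (2 : ℝ)) :=
    Continuous.integrable_of_hasCompactSupport (by fun_prop (disch := intros; simp))
      hc.norm.mul_right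
  have hint_sq : Integrable (fun x => |g x| ^ (2 : ℝ) * (1 + ‖x‖) ^ (0 : ℝ)) := by
    simp only [Real.rpow_zero, mul_one, Real.rpow_two]
    exact Continuous.integrable_of_hasCompactSupport (by fun_prop)
      (hc.comp_left (g := fun t : ℝ => |t| ^ 2) (by simp))
  obtain ⟨s₀, hs₀, hadm⟩ := exists_potAdmissible_abs_mul_rpow (κ := 0) (τ := 1)
    hg.measurable.aemeasurable one_lt_two hint_growth hint_sq (by norm_num)
  have hs : 0 < min s₀ 1 := by positivity
  refine ⟨min s₀ 1, hs, min_le_right _ _, ?_⟩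
  exact ((hadm _ hs.le (min_le_left _ _)).mono (min_le_right _ _) hs.le le_rfl).of_abs_le
    hg.aestronglyMeasurable 1 (Eventually.of_forall fun y => by simp)

theorem tendsto_integral_smoothLog_mul {g : Plane → ℝ} (hg : Continuous g)
    (hc : HasCompactSupport g) :
    Tendsto (fun ε => ∫ x, smoothLog ε x * g x) (nhdsWithin 0 (Set.Ioi 0))
      (nhds (∫ x, Real.log ‖x‖ * g x)) := by
  obtain ⟨s, hs, -, hadm⟩ := exists_potAdmissible_of_hasCompactSupport hg hc
  have hlog : Integrable (fun x => Real.log ‖x‖ * g x) := by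
    simpa using hadm.integrable_log_mul hs 0
  have hsmooth : ∀ {ε : ℝ}, 0 < ε → Continuous (fun x => smoothLog ε x * g x) := fun hε =>
    (contDiff_smoothLog hε).continuous.mul hg
  refine tendsto_integral_filter_of_dominated_convergence
    (fun x => |Real.log ‖x‖ * g x| + |smoothLog 1 x * g x|) ?_ ?_
    (hlog.abs.add ((hsmooth one_pos).integrable_of_hasCompactSupport hc.mul_left).abs) ?_
  · exact eventually_mem_nhdsWithin.mono fun ε hε => (hsmooth hε).aestronglyMeasurable
  · filter_upwards [Ioc_mem_nhdsGT one_pos] with ε hε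
    filter_upwards [volume.ae_ne (0 : Plane)] with x hx
    have hlower := log_norm_le_smoothLog ε hx
    have hupper := smoothLog_le_smoothLog hε.1 hε.2 x
    rw [norm_mul, Real.norm_eq_abs, Real.norm_eq_abs, abs_mul, abs_mul, ← add_mul]
    refine mul_le_mul_of_nonneg_right (abs_le.2 ⟨?_, ?_⟩) (abs_nonneg _)
    · linarith [neg_abs_le (Real.log ‖x‖), abs_nonneg (smoothLog 1 x)]
    · linarith [le_abs_self (smoothLog 1 x), abs_nonneg (Real.log ‖x‖)]
  · filter_upwards [volume.ae_ne (0 : Plane)] with x hx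
    exact ((tendsto_smoothLog hx).mono_left nhdsWithin_le_nhds).mul_const _

theorem tendsto_integral_mul_comp_smul {E : Type*} [NormedAddCommGroup E] [NormedSpace ℝ E]
    [MeasurableSpace E] [BorelSpace E] {μ : Measure E} {ρ f : E → ℝ} (hρ : Integrable ρ μ)
    (hf : Continuous f) {M : ℝ} (hM : ∀ x, ‖f x‖ ≤ M) :
    Tendsto (fun ε : ℝ => ∫ z, ρ z * f (ε • z) ∂μ) (nhds 0) (nhds ((∫ z, ρ z ∂μ) * f 0)) := by
  rw [← integral_mul_const]
  refine tendsto_integral_filter_of_dominated_convergence (fun z => ‖ρ z‖ * M)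
    (Eventually.of_forall fun ε => hρ.aestronglyMeasurable.mul
      (hf.comp (continuous_const_smul ε)).aestronglyMeasurable)
    (Eventually.of_forall fun ε => Eventually.of_forall fun z => ?_) (hρ.norm.mul_const M)
    (Eventually.of_forall fun z => ?_)
  · rw [norm_mul]
    exact mul_le_mul_of_nonneg_left (hM _) (norm_nonneg _)
  · have hcont : Continuous (fun ε : ℝ => ρ z * f (ε • z)) := by fun_prop
    simpa using hcont.tendsto 0

theorem integral_log_norm_mul_laplacian (hφ : ContDiff ℝ ∞ φ) (hc : HasCompactSupport φ) :
    ∫ x, Real.log ‖x‖ * Laplacian.laplacian φ x = 2 * Real.pi * φ 0 := by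
  obtain ⟨M, hM⟩ := hc.exists_bound_of_continuous hφ.continuous
  have hbubble := tendsto_integral_mul_comp_smul integrable_and_integral_inv_one_add_sq_sq.1
    hφ.continuous hM
  rw [integrable_and_integral_inv_one_add_sq_sq.2] at hbubble
  refine tendsto_nhds_unique (tendsto_integral_smoothLog_mul (continuous_laplacian hφ)
    (hasCompactSupport_laplacian hc)) ((hbubble.mono_left nhdsWithin_le_nhds).congr' ?_)
  filter_upwards [self_mem_nhdsWithin] with ε hε
  exact (integral_smoothLog_mul_laplacian hφ hc hε).symm

theorem logPot_laplacian (hφ : ContDiff ℝ ∞ φ) (hc : HasCompactSupport φ) (y : Plane) :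
    logPot (Laplacian.laplacian φ) y = φ y := by
  have hshift := integral_log_norm_mul_laplacian (φ := fun z => φ (z + y))
    (hφ.comp (contDiff_id.add contDiff_const)) (hc.comp_homeomorph (Homeomorph.addRight y))
  simp_rw [laplacian_comp_add_right hφ y, zero_add] at hshift
  rw [← integral_sub_right_eq_self _ y] at hshift
  simp only [sub_add_cancel, norm_sub_rev _ y] at hshift
  rw [logPot, hshift, inv_mul_cancel_left₀ Real.two_pi_pos.ne']

theorem PotAdmissible.integral_logPot_mul {s : ℝ} {h g : Plane → ℝ} (hh : PotAdmissible s s h)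
    (hs : 0 < s) (hg : Integrable (fun x => (1 + ‖x‖) ^ s * g x)) :
    ∫ x, logPot h x * g x = ∫ y, h y * logPot g y := by
  have hswap := integral_integral_swap (f := fun x y => g x * (Real.log ‖x - y‖ * h y))
    (hh.integrable_prod_mul_log_mul hs measurable_id hg)
  calc ∫ x, logPot h x * g x = (2 * Real.pi)⁻¹ * ∫ x, ∫ y, g x * (Real.log ‖x - y‖ * h y) := by
        rw [← integral_const_mul]
        congr 1
        ext x
        rw [integral_const_mul, logPot]
        ring
    _ = ∫ y, h y * logPot g y := by
        rw [hswap, ← integral_const_mul]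
        congr 1
        ext y
        rw [logPot, mul_left_comm, ← integral_const_mul (h y)]
        simp only [norm_sub_rev y]
        congr 2
        ext x
        ring

theorem integral_logPot_mul_laplacian {s : ℝ} {h : Plane → ℝ} (hh : PotAdmissible s s h)
    (hs : 0 < s) (hφ : ContDiff ℝ ∞ φ) (hc : HasCompactSupport φ) :
    ∫ x, logPot h x * Laplacian.laplacian φ x = ∫ y, h y * φ y := by
  rw [hh.integral_logPot_mul hs]
  · simp only [logPot_laplacian hφ hc]
  · exact (Continuous.mul (by fun_prop (disch := intros; positivity))
      (continuous_laplacian hφ)).integrable_of_hasCompactSupport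
        (hasCompactSupport_laplacian hc).mul_left

end FundamentalSolution

section Liouville

variable {E : Type*} [NormedAddCommGroup E] [InnerProductSpace ℝ E] [FiniteDimensional ℝ E]

theorem laplacian_comp_linearIsometryEquiv {F : Type*} [NormedAddCommGroup F]
    [InnerProductSpace ℝ F] [FiniteDimensional ℝ F] (e : E ≃ₗᵢ[ℝ] F) {f : F → ℝ}
    (hf : ContDiff ℝ ∞ f) (x : E) :
    Laplacian.laplacian (fun z => f (e z)) x = Laplacian.laplacian f (e x) := by
  have hfderiv : ∀ {g : F → ℝ}, ContDiff ℝ ∞ g → ∀ z v, fderiv ℝ (fun z => g (e z)) z v =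
      fderiv ℝ g (e z) (e v) := fun {g} hg z v => by
    have hcomp := ((hg.differentiable (by simp)) (e z)).hasFDerivAt.comp z
      (e : E ≃L[ℝ] F).hasFDerivAt
    exact DFunLike.congr_fun (HasFDerivAt.fderiv hcomp) v
  set b := stdOrthonormalBasis ℝ E
  have hcomp : ContDiff ℝ ∞ (fun z => f (e z)) := hf.comp e.contDiff
  rw [laplacian_eq_sum_fderiv b (hcomp.of_le ENat.LEInfty.out),
    laplacian_eq_sum_fderiv (b.map e) (hf.of_le ENat.LEInfty.out)]
  refine Finset.sum_congr rfl fun i _ => ?_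
  simp_rw [hfderiv hf]
  rw [hfderiv (contDiff_fderiv_apply_const hf (e (b i))), OrthonormalBasis.map_apply]

theorem laplacian_comp_const_sub {f : E → ℝ} (hf : ContDiff ℝ ∞ f) (a x : E) :
    Laplacian.laplacian (fun z => f (a - z)) x = Laplacian.laplacian f (a - x) := by
  have hneg := laplacian_comp_linearIsometryEquiv (f := fun z => f (z + a))
    (LinearIsometryEquiv.neg ℝ) (hf.comp (contDiff_id.add contDiff_const)) x
  rw [laplacian_comp_add_right hf] at hneg
  simpa [neg_add_eq_sub] using hneg

section Convolution

variable [MeasurableSpace E] [BorelSpace E] {w g : E → ℝ}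

theorem contDiff_integral_mul_comp_sub (hw : Continuous w) (hg : ContDiff ℝ ∞ g)
    (hc : HasCompactSupport g) : ContDiff ℝ ∞ (fun x => ∫ t, w t * g (x - t)) :=
  hc.contDiff_convolution_right (ContinuousLinearMap.mul ℝ ℝ) (n := (⊤ : ℕ∞))
    (hw.locallyIntegrable (μ := volume)) hg

theorem fderiv_integral_mul_comp_sub_apply (hw : Continuous w) (hg : ContDiff ℝ ∞ g)
    (hc : HasCompactSupport g) (x v : E) :
    fderiv ℝ (fun x => ∫ t, w t * g (x - t)) x v = ∫ t, w t * fderiv ℝ g (x - t) v := by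
  have hg1 : ContDiff ℝ 1 g := hg.of_le (by exact_mod_cast le_top)
  have hw' : LocallyIntegrable w (volume : Measure E) := hw.locallyIntegrable
  have hconv := hc.hasFDerivAt_convolution_right (ContinuousLinearMap.mul ℝ ℝ) hw' hg1 x
  exact (DFunLike.congr_fun (HasFDerivAt.fderiv hconv) v).trans
    (convolution_precompR_apply _ hw' (hc.fderiv ℝ) (hg1.continuous_fderiv one_ne_zero) x v)

theorem laplacian_integral_mul_comp_sub (hw : Continuous w) (hg : ContDiff ℝ ∞ g)
    (hc : HasCompactSupport g) (x : E) :
    Laplacian.laplacian (fun x => ∫ t, w t * g (x - t)) x =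
      ∫ t, w t * Laplacian.laplacian g (x - t) := by
  set b := stdOrthonormalBasis ℝ E
  rw [laplacian_eq_sum_fderiv b
    ((contDiff_integral_mul_comp_sub hw hg hc).of_le ENat.LEInfty.out)]
  simp_rw [laplacian_eq_sum_fderiv b (hg.of_le ENat.LEInfty.out), Finset.mul_sum,
    fderiv_integral_mul_comp_sub_apply hw hg hc]
  rw [integral_finsetSum]
  · refine Finset.sum_congr rfl fun i _ => ?_
    rw [fderiv_integral_mul_comp_sub_apply hw (contDiff_fderiv_apply_const hg _)
      (hc.fderiv_apply ℝ _)]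
  · intro i _
    have hcont := (contDiff_fderiv_apply_const
      (contDiff_fderiv_apply_const hg (b i)) (b i)).continuous
    exact (hw.mul (hcont.comp (continuous_const.sub continuous_id)))
      |>.integrable_of_hasCompactSupport (((hc.fderiv_apply ℝ (b i)).fderiv_apply ℝ
        (b i)).comp_homeomorph (Homeomorph.subLeft x)).mul_left

end Convolution

theorem norm_deriv_le_of_re_le {F : ℂ → ℂ} (hF : Differentiable ℂ F) {M R : ℝ} (hM : 0 < M)
    (hR : 0 < R) (hre : ∀ z, ‖z‖ ≤ R → (F z).re ≤ M) {c : ℂ} (hc : 4 * ‖c‖ ≤ R) :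
    ‖deriv F c‖ ≤ (2 * M + 3 * ‖F 0‖) / (R / 4) := by
  refine Complex.norm_deriv_le_of_forall_mem_sphere_norm_le (by positivity)
    hF.diffContOnCl fun ζ hζ => ?_
  have hζR : ‖ζ‖ ≤ R / 2 := by
    rw [mem_sphere_iff_norm] at hζ
    linarith [norm_le_norm_add_norm_sub' ζ c]
  have hmaps : Set.MapsTo F (Metric.ball 0 R) {z | z.re ≤ M} :=
    fun ξ hξ => hre ξ (mem_ball_zero_iff.1 hξ).le
  refine (Complex.borelCaratheodory hM hF.differentiableOn hmaps hR
    (mem_ball_zero_iff.2 (by linarith))).trans (add_le_add ?_ ?_)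
  · rw [div_le_iff₀ (by linarith)]
    gcongr
    linarith
  · rw [div_le_iff₀ (by linarith)]
    nlinarith [norm_nonneg (F 0)]

theorem entire_eq_of_re_le_isLittleO {F : ℂ → ℂ} (hF : Differentiable ℂ F) {f : ℝ → ℝ}
    (hf : f =o[atTop] (fun R => R)) (hre : ∀ R z, ‖z‖ ≤ R → (F z).re ≤ f R) (z w : ℂ) :
    F z = F w := by
  refine is_const_of_deriv_eq_zero hF (fun c => norm_le_zero_iff.1 ?_) z w
  have hlim : Tendsto (fun R : ℝ => 8 * (|f R| / R) + (8 + 12 * ‖F 0‖) * R⁻¹) atTop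
      (nhds (8 * 0 + (8 + 12 * ‖F 0‖) * 0)) :=
    (hf.abs_left.tendsto_div_nhds_zero.const_mul _).add (tendsto_inv_atTop_zero.const_mul _)
  rw [mul_zero, mul_zero, add_zero] at hlim
  refine ge_of_tendsto hlim ?_
  filter_upwards [eventually_gt_atTop 0, eventually_ge_atTop (4 * ‖c‖)] with R hR hcR
  have hre' : ∀ z, ‖z‖ ≤ R → (F z).re ≤ |f R| + 1 := fun z hz =>
    (hre R z hz).trans (by linarith [le_abs_self (f R)])
  refine (norm_deriv_le_of_re_le hF (by positivity) hR hre' hcR).trans_eq ?_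
  field_simp
  ring

theorem harmonic_eq_of_le_isLittleO {w : Plane → ℝ} (hw : ContDiff ℝ ∞ w)
    (hΔ : ∀ x, Laplacian.laplacian w x = 0) {f : ℝ → ℝ} (hf : f =o[atTop] (fun R => R))
    (hle : ∀ R x, ‖x‖ ≤ R → w x ≤ f R) (x y : Plane) : w x = w y := by
  have hharm : InnerProductSpace.HarmonicOnNhd (fun z => w (planeIso z)) Set.univ := fun z _ =>
    ⟨((hw.comp planeIso.contDiff).of_le ENat.LEInfty.out).contDiffAt,
      Eventually.of_forall fun ζ => (laplacian_comp_linearIsometryEquiv planeIso hw ζ).trans (hΔ _)⟩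
  obtain ⟨F, hF, hre⟩ := hharm.exists_analyticOnNhd_univ_re_eq
  have hre' : ∀ z, (F z).re = w (planeIso z) := congrFun hre
  have hconst := entire_eq_of_re_le_isLittleO (fun z => (hF z trivial).differentiableAt) hf
    (fun R z hz => (hre' z).trans_le (hle R _ ((planeIso.norm_map z).trans_le hz)))
    (planeIso.symm x) (planeIso.symm y)
  simpa only [hre', planeIso.apply_symm_apply] using congrArg Complex.re hconst

section Mollification

variable {w : Plane → ℝ} (ψ : ContDiffBump (0 : Plane))

theorem laplacian_mollification_eq_zero (hw : Continuous w)
    (hweak : ∀ φ : Plane → ℝ, ContDiff ℝ ∞ φ → HasCompactSupport φ →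
      ∫ x, w x * Laplacian.laplacian φ x = 0) (x : Plane) :
    Laplacian.laplacian (fun x => ∫ t, w t * ψ.normed volume (x - t)) x = 0 := by
  rw [laplacian_integral_mul_comp_sub hw ψ.contDiff_normed ψ.hasCompactSupport_normed]
  have htest := hweak (fun z => ψ.normed volume (x - z))
    (ψ.contDiff_normed.comp (contDiff_const.sub contDiff_id))
    (ψ.hasCompactSupport_normed.comp_homeomorph (Homeomorph.subLeft x))
  simpa only [laplacian_comp_const_sub ψ.contDiff_normed] using htest

theorem mollification_le (hw : Continuous w) {M : ℝ} {x : Plane}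
    (hle : ∀ t, ‖t‖ ≤ ψ.rOut → w (x - t) ≤ M) :
    ∫ t, w t * ψ.normed volume (x - t) ≤ M := by
  have hint : Integrable (fun t => w (x - t) * ψ.normed volume t) :=
    ((hw.comp (continuous_const.sub continuous_id)).mul
      ψ.continuous_normed).integrable_of_hasCompactSupport ψ.hasCompactSupport_normed.mul_left
  calc ∫ t, w t * ψ.normed volume (x - t) = ∫ t, w (x - t) * ψ.normed volume t := by
        rw [← integral_sub_left_eq_self _ volume x]
        simp only [sub_sub_cancel]
    _ ≤ ∫ t, M * ψ.normed volume t := by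
        refine integral_mono hint (ψ.integrable_normed.const_mul M) fun t => ?_
        rcases eq_or_ne (ψ.normed volume t) 0 with ht | ht
        · simp only [ht, mul_zero, le_refl]
        have ht' : t ∈ Function.support (ψ.normed volume) := ht
        rw [ψ.support_normed_eq, mem_ball_zero_iff] at ht'
        exact mul_le_mul_of_nonneg_right (hle t ht'.le) (ψ.nonneg_normed t)
    _ = M := by rw [integral_const_mul, ψ.integral_normed, mul_one]

end Mollification

theorem isLittleO_comp_add_one {f : ℝ → ℝ} (hf : f =o[atTop] (fun R => R)) :
    (fun R => f (R + 1)) =o[atTop] (fun R => R) :=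
  (hf.comp_tendsto (tendsto_atTop_add_const_right atTop 1 tendsto_id)).trans_isBigO
    ((isBigO_refl _ _).add (isLittleO_const_id_atTop 1).isBigO)

theorem eq_of_weakly_harmonic {w : Plane → ℝ} (hw : Continuous w)
    (hweak : ∀ φ : Plane → ℝ, ContDiff ℝ ∞ φ → HasCompactSupport φ →
      ∫ x, w x * Laplacian.laplacian φ x = 0)
    {f : ℝ → ℝ} (hf : f =o[atTop] (fun R => R)) (hle : ∀ R x, ‖x‖ ≤ R → w x ≤ f R)
    (x y : Plane) : w x = w y := by
  have hr : ∀ n : ℕ, 1 / ((n : ℝ) + 1) ≤ 1 := fun n =>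
    (div_le_one (by positivity)).2 (by linarith [n.cast_nonneg (α := ℝ)])
  let ψ : ℕ → ContDiffBump (0 : Plane) := fun n =>
    ⟨1 / ((n : ℝ) + 1) / 2, 1 / ((n : ℝ) + 1), by positivity, half_lt_self (by positivity)⟩
  have hconst : ∀ n, ∫ t, w t * (ψ n).normed volume (x - t) =
      ∫ t, w t * (ψ n).normed volume (y - t) := fun n =>
    harmonic_eq_of_le_isLittleO
      (contDiff_integral_mul_comp_sub hw (ψ n).contDiff_normed (ψ n).hasCompactSupport_normed)
      (laplacian_mollification_eq_zero (ψ n) hw hweak) (isLittleO_comp_add_one hf)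
      (fun R x hx => mollification_le (ψ n) hw fun t ht =>
        hle _ _ ((norm_sub_le x t).trans (add_le_add hx (ht.trans (hr n))))) x y
  have hlim : ∀ x, Tendsto (fun n => ∫ t, w t * (ψ n).normed volume (x - t)) atTop
      (nhds (w x)) := fun x => by
    refine (ContDiffBump.convolution_tendsto_right_of_continuous (μ := (volume : Measure Plane))
      (φ := ψ) (l := atTop) tendsto_one_div_add_atTop_nhds_zero_nat hw x).congr fun n => ?_
    rw [convolution, ← integral_sub_left_eq_self _ volume x]
    simp only [sub_sub_cancel, ContinuousLinearMap.lsmul_apply, smul_eq_mul, mul_comm (w _)]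
  exact tendsto_nhds_unique (hlim x) ((hlim y).congr fun n => (hconst n).symm)

end Liouville

section NegativeDefinite

theorem integral_integral_mul_self_nonneg {T Z : Type*} [MeasurableSpace T] [MeasurableSpace Z]
    {μ : Measure T} {ν : Measure Z} [SFinite μ] [SFinite ν] {κ : T → Z → ℝ} {g : T → ℝ}
    (hint : Integrable (Function.uncurry fun (p : T × T) z => κ p.1 z * κ p.2 z * (g p.1 * g p.2))
      ((μ.prod μ).prod ν)) :
    0 ≤ ∫ p : T × T, (∫ z, κ p.1 z * κ p.2 z ∂ν) * (g p.1 * g p.2) ∂μ.prod μ := by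
  simp_rw [← integral_mul_const]
  rw [integral_integral_swap hint]
  refine integral_nonneg fun z => ?_
  calc (0 : ℝ) ≤ (∫ x, κ x z * g x ∂μ) * ∫ y, κ y z * g y ∂μ := mul_self_nonneg _
    _ = ∫ p : T × T, κ p.1 z * κ p.2 z * (g p.1 * g p.2) ∂μ.prod μ := by
        rw [← integral_prod_mul]
        simp only [mul_mul_mul_comm]

variable {E : Type*} [NormedAddCommGroup E] [InnerProductSpace ℝ E] {t : ℝ} {g : E → ℝ}

theorem exp_neg_norm_sq_mul_exp_neg_norm_sq (t : ℝ) (x y z : E) :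
    Real.exp (-(2 * t) * ‖x - z‖ ^ 2) * Real.exp (-(2 * t) * ‖y - z‖ ^ 2) =
      Real.exp (-t * ‖x - y‖ ^ 2) * Real.exp (-(4 * t) * ‖(2 : ℝ)⁻¹ • (x + y) - z‖ ^ 2) := by
  rw [← Real.exp_add, ← Real.exp_add]
  congr 1
  have hparallelogram := parallelogram_law_with_norm ℝ (x - z) (y - z)
  have hmidpoint : (x - z) + (y - z) = (2 : ℝ) • ((2 : ℝ)⁻¹ • (x + y) - z) := by module
  rw [sub_sub_sub_cancel_right, hmidpoint, norm_smul, Real.norm_of_nonneg zero_le_two]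
    at hparallelogram
  linear_combination t * hparallelogram

variable [FiniteDimensional ℝ E] [MeasurableSpace E] [BorelSpace E]

theorem integrable_exp_neg_mul_norm_sq (ht : 0 < t) :
    Integrable (fun z : E => Real.exp (-t * ‖z‖ ^ 2)) := by
  refine .of_integral_ne_zero (ne_of_gt ?_)
  rw [GaussianFourier.integral_rexp_neg_mul_sq_norm ht]
  positivity

theorem integrable_exp_neg_norm_sq_mul_exp_neg_norm_sq (ht : 0 < t) (x y : E) :
    Integrable fun z => Real.exp (-(2 * t) * ‖x - z‖ ^ 2) * Real.exp (-(2 * t) * ‖y - z‖ ^ 2) := by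
  simp_rw [exp_neg_norm_sq_mul_exp_neg_norm_sq]
  exact ((integrable_exp_neg_mul_norm_sq (by positivity : 0 < 4 * t)).comp_sub_left _).const_mul _

theorem integral_exp_neg_norm_sq_mul_exp_neg_norm_sq (t : ℝ) (x y : E) :
    ∫ z, Real.exp (-(2 * t) * ‖x - z‖ ^ 2) * Real.exp (-(2 * t) * ‖y - z‖ ^ 2) =
      (∫ z : E, Real.exp (-(4 * t) * ‖z‖ ^ 2)) * Real.exp (-t * ‖x - y‖ ^ 2) := by
  simp_rw [exp_neg_norm_sq_mul_exp_neg_norm_sq]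
  rw [integral_const_mul, mul_comm, ← integral_sub_left_eq_self
    (fun z : E => Real.exp (-(4 * t) * ‖z‖ ^ 2)) volume ((2 : ℝ)⁻¹ • (x + y))]

theorem integrable_exp_neg_norm_sub_sq_mul (ht : 0 ≤ t) (hg : Integrable g) :
    Integrable (fun p : E × E => Real.exp (-t * ‖p.1 - p.2‖ ^ 2) * (g p.1 * g p.2)) :=
  (hg.mul_prod hg).bdd_mul (c := 1) (Continuous.aestronglyMeasurable (by fun_prop))
    (Eventually.of_forall fun p => by
      rw [Real.norm_of_nonneg (Real.exp_pos _).le]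
      exact Real.exp_le_one_iff.2
        (mul_nonpos_of_nonpos_of_nonneg (neg_nonpos.2 ht) (sq_nonneg _)))

theorem integral_exp_neg_norm_sub_sq_mul_nonneg (ht : 0 < t) (hg : Integrable g) :
    0 ≤ ∫ p : E × E, Real.exp (-t * ‖p.1 - p.2‖ ^ 2) * (g p.1 * g p.2) := by
  set c := ∫ z : E, Real.exp (-(4 * t) * ‖z‖ ^ 2) with hc
  have hc0 : 0 < c := integral_exp_pos (integrable_exp_neg_mul_norm_sq (by positivity))
  have hint : Integrable (Function.uncurry fun (p : E × E) z =>
      Real.exp (-(2 * t) * ‖p.1 - z‖ ^ 2) * Real.exp (-(2 * t) * ‖p.2 - z‖ ^ 2) *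
        (g p.1 * g p.2)) ((volume : Measure (E × E)).prod volume) := by
    refine (integrable_prod_iff ?_).2 ⟨Eventually.of_forall fun p =>
      (integrable_exp_neg_norm_sq_mul_exp_neg_norm_sq ht p.1 p.2).mul_const (g p.1 * g p.2), ?_⟩
    · exact AEStronglyMeasurable.mul (Continuous.aestronglyMeasurable (by fun_prop))
        (hg.mul_prod hg).aestronglyMeasurable.comp_fst
    · refine ((integrable_exp_neg_norm_sub_sq_mul ht.le hg).norm.const_mul c).congr
        (Eventually.of_forall fun p => ?_)
      simp only [Function.uncurry, norm_mul _ (g p.1 * g p.2), Real.norm_of_nonneg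
        (Real.exp_pos _).le, Real.norm_of_nonneg (mul_pos (Real.exp_pos _) (Real.exp_pos _)).le]
      rw [integral_mul_const, integral_exp_neg_norm_sq_mul_exp_neg_norm_sq, mul_assoc]
  have hpos := integral_integral_mul_self_nonneg
    (κ := fun x z => Real.exp (-(2 * t) * ‖x - z‖ ^ 2)) hint
  simp_rw [integral_exp_neg_norm_sq_mul_exp_neg_norm_sq, ← hc, mul_assoc c] at hpos
  rw [integral_const_mul] at hpos
  exact nonneg_of_mul_nonneg_right hpos hc0

theorem abs_exp_neg_sub_exp_neg_le {u v : ℝ} (ht : 0 ≤ t) (huv : u ≤ v) :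
    |Real.exp (-(u * t)) - Real.exp (-(v * t))| ≤ (v - u) * t * Real.exp (-(u * t)) := by
  have hfactor : Real.exp (-(v * t)) = Real.exp (-(u * t)) * Real.exp (-((v - u) * t)) := by
    rw [← Real.exp_add]
    ring_nf
  have htangent := Real.add_one_le_exp (-((v - u) * t))
  have hle : Real.exp (-(v * t)) ≤ Real.exp (-(u * t)) :=
    Real.exp_le_exp.2 (neg_le_neg (mul_le_mul_of_nonneg_right huv ht))
  rw [abs_of_nonneg (sub_nonneg.2 hle), hfactor]
  nlinarith [Real.exp_pos (-(u * t))]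

theorem integrableOn_inv_mul_exp_sub_exp {a : ℝ} (ha : 0 < a) :
    IntegrableOn (fun t : ℝ => t⁻¹ * (Real.exp (-t) - Real.exp (-(a * t)))) (Set.Ioi 0) := by
  refine Integrable.mono' (g := fun t => |a - 1| * Real.exp (-(min 1 a) * t))
    ((exp_neg_integrableOn_Ioi 0 (lt_min one_pos ha)).const_mul _)
    (Measurable.aestronglyMeasurable (by fun_prop)) ?_
  filter_upwards [ae_restrict_mem measurableSet_Ioi] with t (ht : 0 < t)
  rw [norm_mul, norm_inv, Real.norm_of_nonneg ht.le, inv_mul_le_iff₀ ht, Real.norm_eq_abs]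
  rcases le_total 1 a with h | h
  · have hexp := abs_exp_neg_sub_exp_neg_le ht.le h
    rw [one_mul] at hexp
    rw [min_eq_left h, abs_of_nonneg (sub_nonneg.2 h), neg_one_mul]
    linarith
  · have hexp := abs_exp_neg_sub_exp_neg_le ht.le h
    rw [one_mul, abs_sub_comm] at hexp
    rw [min_eq_right h, abs_of_nonpos (sub_nonpos.2 h), neg_mul a t]
    linarith

theorem integral_inv_mul_exp_sub_exp {a : ℝ} (ha : 0 < a) :
    ∫ t in Set.Ioi (0 : ℝ), t⁻¹ * (Real.exp (-t) - Real.exp (-(a * t))) = Real.log a := by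
  have hcont : Continuous fun t : ℝ => Real.exp (-t) := by fun_prop
  have hzero : Tendsto (fun t : ℝ => Real.exp (-t)) (nhdsWithin 0 (Set.Ioi 0)) (nhds 1) := by
    simpa only [neg_zero, Real.exp_zero] using (hcont.tendsto 0).mono_left nhdsWithin_le_nhds
  simpa using Frullani.integral_Ioi_eq (hcont.locallyIntegrable.locallyIntegrableOn _) one_pos ha
    hzero Real.tendsto_exp_neg_atTop_nhds_zero (by simpa using integrableOn_inv_mul_exp_sub_exp ha)

theorem integral_abs_inv_mul_exp_sub_exp {a : ℝ} (ha : 0 < a) :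
    ∫ t in Set.Ioi (0 : ℝ), |t⁻¹ * (Real.exp (-t) - Real.exp (-(a * t)))| = |Real.log a| := by
  rcases le_total 1 a with h | h
  · rw [abs_of_nonneg (Real.log_nonneg h), ← integral_inv_mul_exp_sub_exp ha]
    refine setIntegral_congr_fun measurableSet_Ioi fun t (ht : 0 < t) => abs_of_nonneg
      (mul_nonneg (by positivity) (sub_nonneg.2 (Real.exp_le_exp.2 (neg_le_neg ?_))))
    exact le_mul_of_one_le_left ht.le h
  · rw [abs_of_nonpos (Real.log_nonpos ha.le h), ← integral_inv_mul_exp_sub_exp ha, ← integral_neg]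
    refine setIntegral_congr_fun measurableSet_Ioi fun t (ht : 0 < t) => abs_of_nonpos
      (mul_nonpos_of_nonneg_of_nonpos (by positivity)
        (sub_nonpos.2 (Real.exp_le_exp.2 (neg_le_neg ?_))))
    exact mul_le_of_le_one_left ht.le h

theorem ae_norm_fst_sub_snd_sq_pos [Nontrivial E] : ∀ᵐ p : E × E, 0 < ‖p.1 - p.2‖ ^ 2 := by
  have hne : ∀ᵐ p ∂((volume : Measure E).prod volume), p.1 ≠ p.2 := by
    refine (Measure.ae_prod_iff_ae_ae
      (measurableSet_eq_fun measurable_fst measurable_snd).compl).2 ?_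
    exact Eventually.of_forall fun x => (volume.ae_ne x).mono fun y => Ne.symm
  filter_upwards [hne] with p hp
  exact pow_pos (norm_pos_iff.2 (sub_ne_zero.2 hp)) 2

theorem integrable_frullani_mul [Nontrivial E] (hg : Integrable g)
    (hlog : Integrable (fun p : E × E => Real.log ‖p.1 - p.2‖ * (g p.1 * g p.2))) :
    Integrable (Function.uncurry fun (p : E × E) t =>
        t⁻¹ * (Real.exp (-t) - Real.exp (-(‖p.1 - p.2‖ ^ 2 * t))) * (g p.1 * g p.2))
      ((volume : Measure (E × E)).prod (volume.restrict (Set.Ioi 0))) := by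
  refine (integrable_prod_iff ?_).2 ⟨?_, ?_⟩
  · exact AEStronglyMeasurable.mul (Measurable.aestronglyMeasurable (by fun_prop))
      (hg.mul_prod hg).aestronglyMeasurable.comp_fst
  · filter_upwards [ae_norm_fst_sub_snd_sq_pos] with p hp
    exact Integrable.mul_const (integrableOn_inv_mul_exp_sub_exp hp) (g p.1 * g p.2)
  · refine (hlog.norm.const_mul 2).congr ?_
    filter_upwards [ae_norm_fst_sub_snd_sq_pos] with p hp
    simp only [Function.uncurry, norm_mul _ (g p.1 * g p.2), Real.norm_eq_abs]
    rw [integral_mul_const, integral_abs_inv_mul_exp_sub_exp hp, Real.log_pow, Nat.cast_ofNat,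
      abs_mul 2, abs_two, mul_assoc]

theorem integral_frullani_mul_nonpos (ht : 0 < t) (hg : Integrable g) (hg0 : ∫ x, g x = 0) :
    ∫ p : E × E, t⁻¹ * (Real.exp (-t) - Real.exp (-(‖p.1 - p.2‖ ^ 2 * t))) * (g p.1 * g p.2)
      ≤ 0 := by
  have hgg : Integrable (fun p : E × E => g p.1 * g p.2) := hg.mul_prod hg
  have hmean : ∫ p : E × E, g p.1 * g p.2 = 0 :=
    (integral_prod_mul g g).trans (by rw [hg0, zero_mul])
  calc ∫ p : E × E, t⁻¹ * (Real.exp (-t) - Real.exp (-(‖p.1 - p.2‖ ^ 2 * t))) * (g p.1 * g p.2)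
      = ∫ p : E × E, t⁻¹ * (Real.exp (-t) * (g p.1 * g p.2) -
          Real.exp (-t * ‖p.1 - p.2‖ ^ 2) * (g p.1 * g p.2)) := by
        simp only [mul_assoc, sub_mul, neg_mul, mul_comm _ t]
    _ = -(t⁻¹ * ∫ p : E × E, Real.exp (-t * ‖p.1 - p.2‖ ^ 2) * (g p.1 * g p.2)) := by
        rw [integral_const_mul, integral_sub (hgg.const_mul _)
          (integrable_exp_neg_norm_sub_sq_mul ht.le hg), integral_const_mul, hmean, mul_zero,
          zero_sub, mul_neg]
    _ ≤ 0 := neg_nonpos.2 (mul_nonneg (inv_pos.2 ht).le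
        (integral_exp_neg_norm_sub_sq_mul_nonneg ht hg))

theorem integral_log_norm_sub_mul_nonpos [Nontrivial E] (hg : Integrable g) (hg0 : ∫ x, g x = 0)
    (hlog : Integrable (fun p : E × E => Real.log ‖p.1 - p.2‖ * (g p.1 * g p.2))) :
    ∫ p : E × E, Real.log ‖p.1 - p.2‖ * (g p.1 * g p.2) ≤ 0 := by
  have hfrullani : 2 * ∫ p : E × E, Real.log ‖p.1 - p.2‖ * (g p.1 * g p.2) =
      ∫ p : E × E, ∫ t in Set.Ioi (0 : ℝ),
        t⁻¹ * (Real.exp (-t) - Real.exp (-(‖p.1 - p.2‖ ^ 2 * t))) * (g p.1 * g p.2) := by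
    rw [← integral_const_mul]
    refine integral_congr_ae ?_
    filter_upwards [ae_norm_fst_sub_snd_sq_pos] with p hp
    rw [integral_mul_const, integral_inv_mul_exp_sub_exp hp, Real.log_pow, Nat.cast_ofNat,
      mul_assoc]
  rw [integral_integral_swap (integrable_frullani_mul hg hlog)] at hfrullani
  refine nonpos_of_mul_nonpos_right (hfrullani.trans_le ?_) two_pos
  exact setIntegral_nonpos measurableSet_Ioi fun t ht => integral_frullani_mul_nonpos ht hg hg0

end NegativeDefinite

theorem norm_sub_smul_sq_le {H : Type*} [NormedAddCommGroup H] [InnerProductSpace ℝ H]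
    {v w : H} {m L : ℝ} (hm : 0 < m) (hL : 0 < L) (hw : ‖w‖ ≤ L * ‖v‖)
    (hvw : m * ‖v‖ ^ 2 ≤ inner ℝ w v) :
    ‖v - (m / L ^ 2) • w‖ ^ 2 ≤ (1 - m ^ 2 / L ^ 2) * ‖v‖ ^ 2 := by
  rw [norm_sub_sq_real, inner_smul_right, norm_smul, real_inner_comm,
    Real.norm_of_nonneg (by positivity)]
  calc _ ≤ ‖v‖ ^ 2 - 2 * (m / L ^ 2 * (m * ‖v‖ ^ 2)) + (m / L ^ 2 * (L * ‖v‖)) ^ 2 := by gcongr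
    _ = _ := by field_simp; ring

theorem exists_eq_zero_of_strongly_monotone {H : Type*} [NormedAddCommGroup H]
    [InnerProductSpace ℝ H] [CompleteSpace H] {T : H → H} {m L : ℝ} (hm : 0 < m) (hL : 0 < L)
    (hlip : ∀ x y, ‖T x - T y‖ ≤ L * ‖x - y‖)
    (hmono : ∀ x y, m * ‖x - y‖ ^ 2 ≤ inner ℝ (T x - T y) (x - y)) : ∃ x, T x = 0 := by
  set k := 1 - m ^ 2 / L ^ 2
  have hk : k < 1 := sub_lt_self _ (by positivity)
  let S : H → H := fun x => x - (m / L ^ 2) • T x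
  have hS : ContractingWith (Real.sqrt k).toNNReal S := by
    refine ⟨?_, LipschitzWith.of_dist_le_mul fun x y => ?_⟩
    · rwa [Real.toNNReal_lt_one, Real.sqrt_lt' one_pos, one_pow]
    · rw [dist_eq_norm, dist_eq_norm, Real.coe_toNNReal _ (Real.sqrt_nonneg _)]
      have hsub : S x - S y = (x - y) - (m / L ^ 2) • (T x - T y) := by
        simp only [S, smul_sub]; abel
      calc ‖S x - S y‖ ≤ Real.sqrt (k * ‖x - y‖ ^ 2) := Real.le_sqrt_of_sq_le
            (hsub ▸ norm_sub_smul_sq_le hm hL (hlip x y) (hmono x y))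
        _ = Real.sqrt k * ‖x - y‖ := by
            rw [Real.sqrt_mul' _ (by positivity), Real.sqrt_sq (norm_nonneg _)]
  have hfix : hS.fixedPoint S - (m / L ^ 2) • T (hS.fixedPoint S) = hS.fixedPoint S :=
    hS.fixedPoint_isFixedPt
  rw [sub_eq_self, smul_eq_zero] at hfix
  exact ⟨_, hfix.resolve_left (by positivity)⟩

theorem exists_mem_orthogonal_of_strongly_monotone {H : Type*} [NormedAddCommGroup H]
    [InnerProductSpace ℝ H] (V : Submodule ℝ H) [CompleteSpace V] {T : H → H}
    {m L : ℝ} (hm : 0 < m) (hL : 0 < L) (hlip : ∀ x y, ‖T x - T y‖ ≤ L * ‖x - y‖)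
    (hmono : ∀ x y, x - y ∈ V → m * ‖x - y‖ ^ 2 ≤ inner ℝ (T x - T y) (x - y)) :
    ∃ x ∈ V, T x ∈ Vᗮ := by
  obtain ⟨x, hx⟩ := exists_eq_zero_of_strongly_monotone (H := V)
    (T := fun x => V.orthogonalProjectionOnto (T x)) hm hL
    (fun x y => by
      rw [← map_sub]
      exact (V.norm_orthogonalProjectionOnto_apply_le _).trans (hlip x y))
    (fun x y => by
      rw [← map_sub, Submodule.inner_orthogonalProjectionOnto_eq_of_mem_right]
      exact hmono x y (x - y).2)
  exact ⟨x, x.2, (Submodule.orthogonalProjectionOnto_eq_zero_iff).1 hx⟩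

/-- The logarithm, continued outside `[ε, ε⁻¹]` by affine functions of slope `ε`. For `0 < ε ≤ 1`
it is a strongly monotone and Lipschitz function on all of `ℝ`. -/
noncomputable def truncLog (ε t : ℝ) : ℝ :=
  Real.log (max ε (min t ε⁻¹)) + ε * (t - max ε (min t ε⁻¹))

theorem truncLog_eq_log {ε t : ℝ} (hεt : ε ≤ t) (htε : t ≤ ε⁻¹) : truncLog ε t = Real.log t := by
  rw [truncLog, min_eq_left htε, max_eq_right hεt, sub_self, mul_zero, add_zero]

theorem log_sub_log_le_sub_div {a b : ℝ} (ha : 0 < a) (hb : 0 < b) :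
    Real.log b - Real.log a ≤ (b - a) / a := by
  rw [← Real.log_div hb.ne' ha.ne', sub_div, div_self ha.ne']
  exact Real.log_le_sub_one_of_pos (div_pos hb ha)

theorem max_min_sub_max_min_le (lo hi : ℝ) {a b : ℝ} (hab : a ≤ b) :
    max lo (min b hi) - max lo (min a hi) ≤ b - a := by
  have hmin : min b hi - min a hi ≤ b - a := by
    rcases le_total a hi with h | h
    · rw [min_eq_left h]; gcongr; exact min_le_left _ _
    · rw [min_eq_right h, min_eq_right (h.trans hab)]; linarith
  rw [sub_le_iff_le_add]
  refine max_le ?_ ?_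
  · linarith [le_max_left lo (min a hi)]
  · linarith [le_max_right lo (min a hi)]

section TruncLog

variable {ε : ℝ} (hε0 : 0 < ε) (hε1 : ε ≤ 1)

include hε0 hε1

theorem truncLog_sub_bounds {a b : ℝ} (hab : a ≤ b) :
    ε * (b - a) ≤ truncLog ε b - truncLog ε a ∧ truncLog ε b - truncLog ε a ≤ ε⁻¹ * (b - a) := by
  have hε : ε ≤ ε⁻¹ := hε1.trans ((one_le_inv₀ hε0).2 hε1)
  have hclamp := max_min_sub_max_min_le ε ε⁻¹ hab
  unfold truncLog
  set a' := max ε (min a ε⁻¹)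
  set b' := max ε (min b ε⁻¹)
  have hab' : 0 ≤ b' - a' := sub_nonneg.2 (max_le_max le_rfl (min_le_min hab le_rfl))
  have hεa : ε ≤ a' := le_max_left _ _
  have hbε : b' ≤ ε⁻¹ := max_le hε (min_le_right _ _)
  have ha' : 0 < a' := hε0.trans_le hεa
  have hb' : 0 < b' := by linarith
  have hlower : ε * (b' - a') ≤ Real.log b' - Real.log a' := by
    have hlog := log_sub_log_le_sub_div hb' ha'
    have : ε ≤ b'⁻¹ := (le_inv_comm₀ hε0 hb').2 hbε
    calc ε * (b' - a') ≤ b'⁻¹ * (b' - a') := by gcongr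
      _ = -((a' - b') / b') := by ring
      _ ≤ _ := by linarith
  have hupper : Real.log b' - Real.log a' ≤ ε⁻¹ * (b' - a') := by
    refine (log_sub_log_le_sub_div ha' hb').trans ?_
    rw [div_eq_inv_mul]
    gcongr
  have hslope : ε * ((b - a) - (b' - a')) ≤ ε⁻¹ * ((b - a) - (b' - a')) := by
    gcongr
  constructor <;> linarith

theorem truncLog_strictMono : StrictMono (truncLog ε) := fun a b hab => by
  have hslope := (truncLog_sub_bounds hε0 hε1 hab.le).1
  have : 0 < ε * (b - a) := mul_pos hε0 (sub_pos.2 hab)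
  linarith

theorem abs_truncLog_sub_le (a b : ℝ) : |truncLog ε a - truncLog ε b| ≤ ε⁻¹ * |a - b| := by
  wlog hab : b ≤ a generalizing a b
  · rw [abs_sub_comm, abs_sub_comm a b]
    exact this b a (le_of_not_ge hab)
  rw [abs_of_nonneg (sub_nonneg.2 hab),
    abs_of_nonneg (sub_nonneg.2 ((truncLog_strictMono hε0 hε1).monotone hab))]
  exact (truncLog_sub_bounds hε0 hε1 hab).2

theorem mul_sq_le_truncLog_sub_mul_sub (a b : ℝ) :
    ε * (a - b) ^ 2 ≤ (truncLog ε a - truncLog ε b) * (a - b) := by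
  rcases le_total a b with hab | hab <;>
    nlinarith [(truncLog_sub_bounds hε0 hε1 hab).1]

end TruncLog

section WithDensity

variable {α : Type*} [MeasurableSpace α] {μ : Measure α} {F : α → ℝ} (hF : Measurable F)
  (hF0 : ∀ x, 0 ≤ F x)

include hF hF0

theorem integral_withDensity_ofReal (φ : α → ℝ) :
    ∫ x, φ x ∂(μ.withDensity fun x => ENNReal.ofReal (F x)) = ∫ x, φ x * F x ∂μ := by
  rw [integral_withDensity_eq_integral_toReal_smul (by fun_prop) (by simp)]
  simp only [ENNReal.toReal_ofReal (hF0 _), smul_eq_mul, mul_comm]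

theorem integrable_withDensity_ofReal {φ : α → ℝ} :
    Integrable φ (μ.withDensity fun x => ENNReal.ofReal (F x)) ↔
      Integrable (fun x => φ x * F x) μ := by
  rw [integrable_withDensity_iff_integrable_smul' (by fun_prop) (by simp)]
  simp only [ENNReal.toReal_ofReal (hF0 _), smul_eq_mul, mul_comm]

theorem ae_withDensity_ofReal {P : α → Prop} :
    (∀ᵐ x ∂(μ.withDensity fun x => ENNReal.ofReal (F x)), P x) ↔ ∀ᵐ x ∂μ, F x ≠ 0 → P x := by
  rw [ae_withDensity_iff (by fun_prop)]
  simp only [ne_eq, ENNReal.ofReal_eq_zero, (hF0 _).ge_iff_eq']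

end WithDensity

section SquareIntegrableWeights

variable {E : Type*} [NormedAddCommGroup E] {τ s : ℝ}

theorem rpow_half_sq {a : ℝ} (ha : 0 ≤ a) (s : ℝ) : (a ^ (s / 2)) ^ 2 = a ^ s := by
  rw [← Real.rpow_mul_natCast ha, Nat.cast_two, div_mul_cancel₀ s two_ne_zero]

theorem one_add_norm_rpow_le_potWeight (τ s : ℝ) (x y : E) :
    (1 + ‖y‖) ^ τ ≤ potWeight τ s x y :=
  le_mul_of_one_le_right (by positivity) (le_add_of_nonneg_right (by positivity))

theorem potWeight_half_sq_le (τ s : ℝ) (x y : E) :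
    potWeight (τ / 2) (s / 2) x y ^ 2 ≤ 2 * potWeight τ s x y := by
  unfold potWeight
  rw [mul_pow, rpow_half_sq (by positivity), ← neg_div]
  calc (1 + ‖y‖) ^ τ * (1 + ‖x - y‖ ^ (-s / 2)) ^ 2
      ≤ (1 + ‖y‖) ^ τ * (2 * (1 ^ 2 + (‖x - y‖ ^ (-s / 2)) ^ 2)) := by
        gcongr
        exact add_sq_le
    _ = _ := by rw [rpow_half_sq (norm_nonneg _), one_pow, mul_left_comm]

theorem log_norm_sub_sq_le_potWeight (hs : 0 < s) (x y : E) :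
    Real.log ‖x - y‖ ^ 2 ≤ 8 / s ^ 2 * (1 + ‖x‖) ^ s * potWeight s s x y :=
  calc Real.log ‖x - y‖ ^ 2 = |Real.log ‖x - y‖| ^ 2 := (sq_abs _).symm
    _ ≤ ((s / 2)⁻¹ * (1 + ‖x‖) ^ (s / 2) * potWeight (s / 2) (s / 2) x y) ^ 2 := by
        gcongr
        exact abs_log_norm_sub_le_potWeight (half_pos hs) x y
    _ = 4 / s ^ 2 * (1 + ‖x‖) ^ s * potWeight (s / 2) (s / 2) x y ^ 2 := by
        rw [mul_pow, mul_pow, rpow_half_sq (by positivity)]; field_simp; ring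
    _ ≤ 4 / s ^ 2 * (1 + ‖x‖) ^ s * (2 * potWeight s s x y) := by
        gcongr
        exact potWeight_half_sq_le s s x y
    _ = _ := by ring

namespace PotAdmissible

variable [MeasureSpace E] [BorelSpace E] {F g : E → ℝ}

theorem mul_of_sq_integrable (hF : PotAdmissible τ s F) (hF0 : ∀ x, 0 ≤ F x)
    (hg : AEStronglyMeasurable (fun x => g x * F x) volume)
    (hg2 : Integrable (fun x => g x ^ 2 * F x)) :
    PotAdmissible (τ / 2) (s / 2) (fun x => g x * F x) := by
  obtain ⟨C, hC⟩ := hF.exists_integral_le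
  have hle : ∀ x y, potWeight (τ / 2) (s / 2) x y * |g y * F y| ≤
      g y ^ 2 * F y + potWeight τ s x y * |F y| := fun x y => by
    rw [abs_mul, abs_of_nonneg (hF0 y), ← mul_assoc, ← add_mul]
    refine mul_le_mul_of_nonneg_right ?_ (hF0 y)
    nlinarith [potWeight_half_sq_le τ s x y, sq_abs (g y), sq_nonneg (g y),
      two_mul_le_add_sq (potWeight (τ / 2) (s / 2) x y) |g y|]
  have hint : ∀ x, Integrable (fun y => potWeight (τ / 2) (s / 2) x y * |g y * F y|) := fun x =>
    (hg2.add (hC x).1).mono' ((measurable_potWeight _ _ x).aestronglyMeasurable.mul hg.norm)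
      (Eventually.of_forall fun y => by
        rw [Real.norm_of_nonneg (mul_nonneg (potWeight_nonneg _ _ _ _) (abs_nonneg _))]
        exact hle x y)
  refine ⟨hg, (∫ x, g x ^ 2 * F x) + C, fun x => ⟨hint x, ?_⟩⟩
  calc _ ≤ ∫ y, (g y ^ 2 * F y + potWeight τ s x y * |F y|) :=
        integral_mono (hint x) (hg2.add (hC x).1) (hle x)
    _ = (∫ y, g y ^ 2 * F y) + ∫ y, potWeight τ s x y * |F y| := integral_add hg2 (hC x).1
    _ ≤ _ := by gcongr; exact (hC x).2

theorem exists_integral_log_sq_mul_le (hF : PotAdmissible s s F) (hs : 0 < s) :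
    ∃ A, 0 ≤ A ∧ ∀ x, Integrable (fun y => Real.log ‖x - y‖ ^ 2 * F y) ∧
      ∫ y, Real.log ‖x - y‖ ^ 2 * F y ≤ (A * (1 + ‖x‖) ^ (s / 2)) ^ 2 := by
  obtain ⟨C, hC0, hC⟩ := hF.exists_integral_abs_mul_le
  have hle : ∀ x y : E, |Real.log ‖x - y‖ ^ 2| ≤
      8 / s ^ 2 * (1 + ‖x‖) ^ s * potWeight s s x y := fun x y => by
    rw [abs_of_nonneg (sq_nonneg _)]
    exact log_norm_sub_sq_le_potWeight hs x y
  refine ⟨Real.sqrt (8 / s ^ 2 * C), Real.sqrt_nonneg _, fun x => ⟨?_, ?_⟩⟩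
  · exact hF.integrable_mul (Measurable.aestronglyMeasurable (by fun_prop)) x
      (Eventually.of_forall (hle x))
  · calc _ ≤ ∫ y, |Real.log ‖x - y‖ ^ 2 * F y| :=
          (le_abs_self _).trans abs_integral_le_integral_abs
      _ ≤ 8 / s ^ 2 * (1 + ‖x‖) ^ s * C :=
          hC _ _ x (by positivity) (Eventually.of_forall (hle x))
      _ = _ := by
          rw [mul_pow, Real.sq_sqrt (by positivity), rpow_half_sq (by positivity)]; ring

end PotAdmissible

end SquareIntegrableWeights

theorem PotAdmissible.aestronglyMeasurable_logPot {τ s : ℝ} {h : Plane → ℝ}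
    (hh : PotAdmissible τ s h) : AEStronglyMeasurable (logPot h) volume := by
  have hm : AEStronglyMeasurable (fun p : Plane × Plane => Real.log ‖p.1 - p.2‖ * h p.2)
      (volume.prod volume) :=
    (Measurable.aestronglyMeasurable (by fun_prop)).mul hh.aestronglyMeasurable.comp_snd
  exact hm.integral_prod_right'.const_mul _

theorem PotAdmissible.integral_logPot_mul_self_nonpos {s : ℝ} {h : Plane → ℝ}
    (hh : PotAdmissible s s h) (hs : 0 < s) (hint : Integrable (fun x => (1 + ‖x‖) ^ s * h x))
    (h0 : ∫ x, h x = 0) : ∫ x, logPot h x * h x ≤ 0 := by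
  have hlog : Integrable (fun p : Plane × Plane => Real.log ‖p.1 - p.2‖ * (h p.1 * h p.2))
      (volume.prod volume) := by
    simpa only [id, mul_left_comm] using hh.integrable_prod_mul_log_mul hs measurable_id hint
  calc ∫ x, logPot h x * h x
      = ∫ x, (2 * Real.pi)⁻¹ * ∫ y, Real.log ‖x - y‖ * (h x * h y) := by
        congr 1; ext x
        rw [logPot, mul_assoc, ← integral_mul_const]
        congr 2; ext y; ring
    _ = (2 * Real.pi)⁻¹ * ∫ p : Plane × Plane, Real.log ‖p.1 - p.2‖ * (h p.1 * h p.2) := by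
        rw [integral_const_mul, Measure.volume_eq_prod, integral_prod _ hlog]
    _ ≤ 0 := mul_nonpos_of_nonneg_of_nonpos (by positivity)
        (integral_log_norm_sub_mul_nonpos (hh.integrable hs.le) h0 hlog)

/-- The measure `F dx`, for a nonnegative density `F`. -/
noncomputable abbrev densityMeasure (F : Plane → ℝ) : Measure Plane :=
  volume.withDensity fun x => ENNReal.ofReal (F x)

namespace PotAdmissible

section LogPotOperator

variable {τ s : ℝ} {F : Plane → ℝ}

theorem isFiniteMeasure_densityMeasure (hF : PotAdmissible τ s F) (hτ : 0 ≤ τ) :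
    IsFiniteMeasure (densityMeasure F) :=
  isFiniteMeasure_withDensity_ofReal (hF.integrable hτ).2

theorem mul_Lp (hF : PotAdmissible τ s F) (hτ : 0 ≤ τ) (hFm : Measurable F) (hF0 : ∀ x, 0 ≤ F x)
    (g : Lp ℝ 2 (densityMeasure F)) : PotAdmissible (τ / 2) (s / 2) (fun x => g x * F x) := by
  have := hF.isFiniteMeasure_densityMeasure hτ
  refine hF.mul_of_sq_integrable hF0 (Integrable.aestronglyMeasurable (μ := volume) ?_)
    ((integrable_withDensity_ofReal hFm hF0).1 (Lp.memLp g).integrable_sq)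
  exact (integrable_withDensity_ofReal hFm hF0).1 ((Lp.memLp g).integrable one_le_two)

variable (hF : PotAdmissible s s F) (hs : 0 < s) (hFm : Measurable F) (hF0 : ∀ x, 0 ≤ F x)

include hF hs hFm hF0

theorem exists_logPot_eq_inner :
    ∃ (A : ℝ) (k : Plane → Lp ℝ 2 (densityMeasure F)),
      (∀ x, ‖k x‖ ≤ A * (1 + ‖x‖) ^ (s / 2)) ∧
      ∀ (g : Lp ℝ 2 (densityMeasure F)) x, logPot (fun y => g y * F y) x = inner ℝ (k x) g := by
  obtain ⟨A, hA0, hA⟩ := hF.exists_integral_log_sq_mul_le hs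
  have hk : ∀ x, MemLp (fun y => Real.log ‖x - y‖) 2 (densityMeasure F) := fun x => by
    have hm : Measurable fun y : Plane => Real.log ‖x - y‖ := by fun_prop
    rw [memLp_two_iff_integrable_sq hm.aestronglyMeasurable, integrable_withDensity_ofReal hFm hF0]
    exact (hA x).1
  have hinner : ∀ x (g : Lp ℝ 2 (densityMeasure F)),
      inner ℝ (hk x).toLp g = ∫ y, Real.log ‖x - y‖ * g y ∂densityMeasure F := fun x g => by
    rw [L2.inner_def]
    refine integral_congr_ae ?_
    filter_upwards [(hk x).coeFn_toLp] with y hy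
    rw [hy]
    exact mul_comm _ _
  have hnorm : ∀ x, ‖(hk x).toLp‖ ≤ A * (1 + ‖x‖) ^ (s / 2) := fun x => by
    refine le_of_sq_le_sq ?_ (by positivity)
    calc ‖(hk x).toLp‖ ^ 2 = ∫ y, Real.log ‖x - y‖ * (hk x).toLp _ y ∂densityMeasure F := by
          rw [← hinner, real_inner_self_eq_norm_sq]
      _ = ∫ y, Real.log ‖x - y‖ ^ 2 ∂densityMeasure F := by
          refine integral_congr_ae ?_
          filter_upwards [(hk x).coeFn_toLp] with y hy
          rw [hy, sq]
      _ ≤ _ := by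
          rw [integral_withDensity_ofReal hFm hF0]
          exact (hA x).2
  refine ⟨(2 * Real.pi)⁻¹ * A, fun x => (2 * Real.pi)⁻¹ • (hk x).toLp, fun x => ?_,
    fun g x => ?_⟩
  · rw [norm_smul, Real.norm_of_nonneg (by positivity), mul_assoc]
    gcongr
    exact hnorm x
  · rw [real_inner_smul_left, hinner, integral_withDensity_ofReal hFm hF0, logPot]
    simp only [mul_assoc]

omit hs in
theorem memLp_one_add_norm_rpow_half :
    MemLp (fun x : Plane => (1 + ‖x‖) ^ (s / 2)) 2 (densityMeasure F) := by
  have hm : Measurable fun y : Plane => (1 + ‖y‖) ^ (s / 2) := by fun_prop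
  rw [memLp_two_iff_integrable_sq hm.aestronglyMeasurable, integrable_withDensity_ofReal hFm hF0]
  refine hF.integrable_mul (c := 1) (hm.pow_const 2).aestronglyMeasurable 0
    (Eventually.of_forall fun y => ?_)
  rw [abs_of_nonneg (by positivity), rpow_half_sq (by positivity), one_mul]
  exact one_add_norm_rpow_le_potWeight s s 0 y

theorem integral_logPot_mul_nonpos (g : Lp ℝ 2 (densityMeasure F))
    (hg : ∫ x, g x ∂densityMeasure F = 0) :
    ∫ x, logPot (fun y => g y * F y) x * g x ∂densityMeasure F ≤ 0 := by
  rw [integral_withDensity_ofReal hFm hF0] at hg ⊢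
  simp only [mul_assoc]
  refine (hF.mul_Lp hs.le hFm hF0 g).integral_logPot_mul_self_nonpos (half_pos hs) ?_ hg
  have hint : Integrable (fun x => (1 + ‖x‖) ^ (s / 2) * g x) (densityMeasure F) :=
    (hF.memLp_one_add_norm_rpow_half hFm hF0).integrable_mul (Lp.memLp g)
  simpa only [mul_assoc] using (integrable_withDensity_ofReal hFm hF0).1 hint

theorem exists_logPot_clm :
    ∃ N : Lp ℝ 2 (densityMeasure F) →L[ℝ] Lp ℝ 2 (densityMeasure F),
      (∀ g, N g =ᵐ[densityMeasure F] logPot fun y => g y * F y) ∧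
      ∀ g : Lp ℝ 2 (densityMeasure F), ∫ x, g x ∂densityMeasure F = 0 → inner ℝ (N g) g ≤ 0 := by
  obtain ⟨A, k, hk, hpot⟩ := hF.exists_logPot_eq_inner hs hFm hF0
  have hw := hF.memLp_one_add_norm_rpow_half hFm hF0
  have hbound : ∀ (g : Lp ℝ 2 (densityMeasure F)) x, ‖logPot (fun y => g y * F y) x‖ ≤
      A * ‖g‖ * ‖(1 + ‖x‖) ^ (s / 2)‖ := fun g x =>
    calc _ ≤ ‖k x‖ * ‖g‖ := hpot g x ▸ norm_inner_le_norm _ _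
      _ ≤ A * (1 + ‖x‖) ^ (s / 2) * ‖g‖ := by gcongr; exact hk x
      _ = _ := by rw [Real.norm_of_nonneg (by positivity)]; ring
  have hmem : ∀ g : Lp ℝ 2 (densityMeasure F),
      MemLp (logPot fun y => g y * F y) 2 (densityMeasure F) := fun g =>
    hw.of_le_mul ((hF.mul_Lp hs.le hFm hF0 g).aestronglyMeasurable_logPot.mono_ac
      (withDensity_absolutelyContinuous _ _)) (Eventually.of_forall (hbound g))
  refine ⟨LinearMap.mkContinuous
    { toFun := fun g => (hmem g).toLp
      map_add' := fun g g' => ?_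
      map_smul' := fun c g => ?_ } (A * ‖hw.toLp‖) fun g => ?_,
    fun g => (hmem g).coeFn_toLp, fun g hg => ?_⟩
  · rw [← MemLp.toLp_add]
    refine MemLp.toLp_congr _ _ (Eventually.of_forall fun x => ?_)
    simp only [Pi.add_apply, hpot, inner_add_right]
  · rw [RingHom.id_apply, ← MemLp.toLp_const_smul]
    refine MemLp.toLp_congr _ _ (Eventually.of_forall fun x => ?_)
    simp only [Pi.smul_apply, hpot, real_inner_smul_right, smul_eq_mul]
  · rw [mul_right_comm]
    refine Lp.norm_le_mul_norm_of_ae_le_mul ?_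
    filter_upwards [(hmem g).coeFn_toLp, hw.coeFn_toLp] with x hgx hwx
    change ‖(hmem g).toLp _ x‖ ≤ _
    rw [hgx, hwx]
    exact hbound g x
  · refine le_of_eq_of_le ?_ (hF.integral_logPot_mul_nonpos hs hFm hF0 g hg)
    rw [L2.inner_def]
    refine integral_congr_ae ?_
    filter_upwards [(hmem g).coeFn_toLp] with x hx
    change inner ℝ ((hmem g).toLp _ x) (g x) = _
    rw [hx]
    exact mul_comm _ _

end LogPotOperator

end PotAdmissible

section Nemytskii

variable {α : Type*} [MeasurableSpace α] {μ : Measure α} {θ : ℝ → ℝ} {m : ℝ} {L : NNReal}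

theorem mul_norm_sub_sq_le_inner_compLp_sub
    (hmono : ∀ a b, m * (a - b) ^ 2 ≤ (θ a - θ b) * (a - b)) (hlip : LipschitzWith L θ)
    (hθ0 : θ 0 = 0) (g g' : Lp ℝ 2 μ) :
    m * ‖g - g'‖ ^ 2 ≤ inner ℝ (hlip.compLp hθ0 g - hlip.compLp hθ0 g') (g - g') := by
  rw [← real_inner_self_eq_norm_sq, L2.inner_def, L2.inner_def, ← integral_const_mul]
  refine integral_mono_ae ((L2.integrable_inner _ _).const_mul _) (L2.integrable_inner _ _) ?_
  filter_upwards [hlip.coeFn_compLp hθ0 g, hlip.coeFn_compLp hθ0 g',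
    Lp.coeFn_sub (hlip.compLp hθ0 g) (hlip.compLp hθ0 g'), Lp.coeFn_sub g g'] with x hg hg' hθ hsub
  simp only [hg, hg', hθ, hsub, Pi.sub_apply, Function.comp_apply, RCLike.inner_apply,
    conj_trivial]
  linarith [hmono (g x) (g' x)]

variable [IsFiniteMeasure μ]

theorem mem_orthogonal_span_const_one_iff (g : Lp ℝ 2 μ) :
    g ∈ (Submodule.span ℝ {Lp.const 2 μ (1 : ℝ)})ᗮ ↔ ∫ x, g x ∂μ = 0 := by
  rw [Submodule.mem_orthogonal_singleton_iff_inner_right, ← indicatorConstLp_univ,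
    L2.inner_indicatorConstLp_one, setIntegral_univ]

theorem exists_ae_comp_eq_const_add_clm (hm : 0 < m)
    (hmono : ∀ a b, m * (a - b) ^ 2 ≤ (θ a - θ b) * (a - b)) (hlip : LipschitzWith L θ)
    (hθ0 : θ 0 = 0) (N : Lp ℝ 2 μ →L[ℝ] Lp ℝ 2 μ)
    (hN : ∀ g : Lp ℝ 2 μ, ∫ x, g x ∂μ = 0 → inner ℝ (N g) g ≤ 0) (b : Lp ℝ 2 μ) :
    ∃ (c : ℝ) (g : Lp ℝ 2 μ), ∫ x, g x ∂μ = 0 ∧ ∀ᵐ x ∂μ, θ (g x) = c + N g x - b x := by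
  let T : Lp ℝ 2 μ → Lp ℝ 2 μ := fun g => hlip.compLp hθ0 g + b - N g
  have hTsub : ∀ g g', T g - T g' = (hlip.compLp hθ0 g - hlip.compLp hθ0 g') - N (g - g') :=
    fun g g' => by simp only [T, map_sub]; abel
  have hTlip : ∀ g g', ‖T g - T g'‖ ≤ (m + L + ‖N‖) * ‖g - g'‖ := fun g g' => by
    have hθ := hlip.norm_compLp_sub_le hθ0 g g'
    have : 0 ≤ m * ‖g - g'‖ := by positivity
    rw [hTsub]
    linarith [norm_sub_le (hlip.compLp hθ0 g - hlip.compLp hθ0 g') (N (g - g')),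
      N.le_opNorm (g - g')]
  obtain ⟨g, hg, hTg⟩ := exists_mem_orthogonal_of_strongly_monotone
    (Submodule.span ℝ {Lp.const 2 μ (1 : ℝ)})ᗮ hm (by positivity) hTlip fun g g' hgg' => by
      have hNgg' := hN (g - g') ((mem_orthogonal_span_const_one_iff _).1 hgg')
      rw [hTsub, inner_sub_left]
      linarith [mul_norm_sub_sq_le_inner_compLp_sub hmono hlip hθ0 g g']
  rw [Submodule.orthogonal_orthogonal, Submodule.mem_span_singleton] at hTg
  obtain ⟨c, hc⟩ := hTg
  refine ⟨c, g, (mem_orthogonal_span_const_one_iff g).1 hg, ?_⟩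
  have hcT : hlip.compLp hθ0 g = c • Lp.const 2 μ (1 : ℝ) + N g - b := by
    rw [hc]; simp only [T]; abel
  filter_upwards [hlip.coeFn_compLp hθ0 g, Lp.coeFn_sub (c • Lp.const 2 μ (1 : ℝ) + N g) b,
    Lp.coeFn_add (c • Lp.const 2 μ (1 : ℝ)) (N g), Lp.coeFn_smul c (Lp.const 2 μ (1 : ℝ)),
    Lp.coeFn_const (p := 2) (μ := μ) (1 : ℝ)] with x hθ hsub hadd hsmul hconst
  rw [← hcT, hθ] at hsub
  simpa only [Function.comp_apply, Pi.sub_apply, hadd, Pi.add_apply, hsmul, Pi.smul_apply, hconst,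
    Function.const_apply, smul_eq_mul, mul_one] using hsub

end Nemytskii

theorem exists_truncated_density {τ s : ℝ} (hs : 0 < s) (hsτ : s ≤ τ) {F : Plane → ℝ}
    (hF : PotAdmissible τ s F) (hFm : Measurable F) (hF0 : ∀ x, 0 ≤ F x) {b : Plane → ℝ}
    (hb : Continuous b) {B : ℝ} (hB : ∀ x, |b x| ≤ B) (m : ℝ) {ε : ℝ} (hε0 : 0 < ε) (hε1 : ε ≤ 1) :
    ∃ (c : ℝ) (g : Plane → ℝ), PotAdmissible (τ / 2) (s / 2) (fun x => g x * F x) ∧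
      ∫ x, g x * F x = 0 ∧
      ∀ᵐ x, F x ≠ 0 →
        2⁻¹ * truncLog ε (m + g x) = c + logPot (fun y => g y * F y) x - b x := by
  have := hF.isFiniteMeasure_densityMeasure (hs.le.trans hsτ)
  obtain ⟨N, hN, hNneg⟩ := (hF.mono hsτ hs.le le_rfl).exists_logPot_clm hs hFm hF0
  let θ : ℝ → ℝ := fun t => 2⁻¹ * truncLog ε (m + t) - 2⁻¹ * truncLog ε m
  have hmono : ∀ a b, 2⁻¹ * ε * (a - b) ^ 2 ≤ (θ a - θ b) * (a - b) := fun a b => by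
    have hlog := mul_sq_le_truncLog_sub_mul_sub hε0 hε1 (m + a) (m + b)
    rw [add_sub_add_left_eq_sub] at hlog
    simp only [θ]
    linarith
  have hlip : LipschitzWith (2⁻¹ * ε⁻¹).toNNReal θ := by
    refine LipschitzWith.of_dist_le_mul fun x y => ?_
    have hlog := abs_truncLog_sub_le hε0 hε1 (m + x) (m + y)
    rw [add_sub_add_left_eq_sub] at hlog
    rw [Real.dist_eq, Real.dist_eq, Real.coe_toNNReal _ (by positivity), sub_sub_sub_cancel_right,
      ← mul_sub, abs_mul, abs_of_pos (by norm_num : (0 : ℝ) < 2⁻¹), mul_assoc]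
    gcongr
  have hbm : MemLp b 2 (densityMeasure F) :=
    MemLp.of_bound hb.aestronglyMeasurable B (Eventually.of_forall hB)
  obtain ⟨c, g, hg0, hg⟩ := exists_ae_comp_eq_const_add_clm (by positivity) hmono hlip
    (by simp [θ]) N hNneg hbm.toLp
  refine ⟨c + 2⁻¹ * truncLog ε m, g, hF.mul_Lp (hs.le.trans hsτ) hFm hF0 g, ?_, ?_⟩
  · rwa [← integral_withDensity_ofReal hFm hF0]
  · rw [← ae_withDensity_ofReal hFm hF0]
    filter_upwards [hg, hN g, hbm.coeFn_toLp] with x hx hNx hbx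
    rw [hNx, hbx] at hx
    simp only [θ] at hx
    linarith

theorem abs_logPot_sub_le_or_ae_eq_zero {γ s : ℝ} {k : Plane → ℝ} (hk : PotAdmissible (γ + s) s k)
    (hγ : 0 < γ) (hs : 0 < s) (hγs : γ + s ≤ 1) (hk0 : ∫ x, k x = 0) {a B : ℝ}
    (hup : ∀ᵐ x, a + B < logPot k x → 0 ≤ k x) (hdown : ∀ᵐ x, logPot k x < a - B → k x ≤ 0) :
    (∀ x, |logPot k x - a| ≤ B) ∨ k =ᵐ[volume] 0 := by
  have hneg : PotAdmissible (γ + s) s (fun x => -k x) :=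
    hk.of_abs_le hk.aestronglyMeasurable.neg 1 (Eventually.of_forall fun y => by simp)
  rcases logPot_le_or_ae_eq_zero hk hγ hs hγs hk0 hup with hle | h0
  · rcases logPot_le_or_ae_eq_zero hneg hγ hs hγs (B := B - a) (by rw [integral_neg, hk0, neg_zero])
      (by
        filter_upwards [hdown] with x hx hlt
        rw [logPot_neg] at hlt
        linarith [hx (by linarith)]) with hge | h0
    · refine Or.inl fun x => abs_le.2 ⟨?_, ?_⟩
      · linarith [logPot_neg k x ▸ hge x]
      · linarith [hle x]
    · right
      filter_upwards [h0] with x hx using neg_eq_zero.1 hx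
  · exact Or.inr h0

theorem ae_abs_strictMono_sub_le {γ s : ℝ} (hγ : 0 < γ) (hs : 0 < s) (hγs : γ + s ≤ 1)
    {F g b : Plane → ℝ} (hk : PotAdmissible (γ + s) s (fun x => g x * F x)) (hF0 : ∀ x, 0 ≤ F x)
    (hk0 : ∫ x, g x * F x = 0) {B : ℝ} (hB : ∀ x, |b x| ≤ B) {θ : ℝ → ℝ} (hθ : StrictMono θ)
    {m c : ℝ}
    (hg : ∀ᵐ x, F x ≠ 0 → 2⁻¹ * θ (m + g x) = c + logPot (fun y => g y * F y) x - b x) :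
    ∀ᵐ x, F x ≠ 0 → |θ (m + g x) - θ m| ≤ 4 * B := by
  have hb : ∀ x, -B ≤ b x ∧ b x ≤ B := fun x => abs_le.1 (hB x)
  have hup : ∀ᵐ x, 2⁻¹ * θ m - c + B < logPot (fun y => g y * F y) x → 0 ≤ g x * F x := by
    filter_upwards [hg] with x hx hlt
    rcases eq_or_ne (F x) 0 with hFx | hFx
    · rw [hFx, mul_zero]
    · have hθlt : θ m < θ (m + g x) := by linarith [hx hFx, (hb x).2]
      exact mul_nonneg (by linarith [hθ.lt_iff_lt.1 hθlt]) (hF0 x)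
  have hdown : ∀ᵐ x, logPot (fun y => g y * F y) x < 2⁻¹ * θ m - c - B → g x * F x ≤ 0 := by
    filter_upwards [hg] with x hx hlt
    rcases eq_or_ne (F x) 0 with hFx | hFx
    · rw [hFx, mul_zero]
    · have hθlt : θ (m + g x) < θ m := by linarith [hx hFx, (hb x).1]
      exact mul_nonpos_of_nonpos_of_nonneg (by linarith [hθ.lt_iff_lt.1 hθlt]) (hF0 x)
  rcases abs_logPot_sub_le_or_ae_eq_zero hk hγ hs hγs hk0 hup hdown with hle | h0
  · filter_upwards [hg] with x hx hFx
    obtain ⟨hlow, hhigh⟩ := abs_le.1 (hle x)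
    rw [abs_le]
    constructor <;> linarith [hx hFx, (hb x).1, (hb x).2]
  · filter_upwards [h0] with x hx hFx
    rw [(mul_eq_zero.1 hx).resolve_right hFx, add_zero, sub_self, abs_zero]
    linarith [hb x]

/- The maximum principle bounds the solution of the truncated equation independently of the
truncation, which is therefore inactive once `ε` is small. -/
theorem exists_bounded_density {γ s : ℝ} (hγ : 0 < γ) (hs : 0 < s) (hγs : γ + s ≤ 1)
    {F : Plane → ℝ} (hF : PotAdmissible (γ + s) s F) (hFm : Measurable F) (hF0 : ∀ x, 0 ≤ F x)
    {b : Plane → ℝ} (hb : Continuous b) {B : ℝ} (hB : ∀ x, |b x| ≤ B) {m : ℝ} (hm : 0 < m) :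
    ∃ (c M : ℝ) (g : Plane → ℝ), PotAdmissible ((γ + s) / 2) (s / 2) (fun x => g x * F x) ∧
      ∫ x, g x * F x = 0 ∧ ∀ᵐ x, F x ≠ 0 → 0 < m + g x ∧ m + g x ≤ M ∧
        2⁻¹ * Real.log (m + g x) = c + logPot (fun y => g y * F y) x - b x := by
  have hB0 : 0 ≤ B := (abs_nonneg _).trans (hB 0)
  set lo := m * Real.exp (-(4 * B)) with hlo
  set hi := m * Real.exp (4 * B) with hhi
  have hlo0 : 0 < lo := by positivity
  have hhi0 : 0 < hi := by positivity
  have hlom : lo ≤ m := mul_le_of_le_one_right hm.le (Real.exp_le_one_iff.2 (by linarith))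
  have hmhi : m ≤ hi := le_mul_of_one_le_right hm.le (Real.one_le_exp (by linarith))
  obtain ⟨ε, hε0, hε1, hεlo, hεhi⟩ : ∃ ε : ℝ, 0 < ε ∧ ε ≤ 1 ∧ ε ≤ lo ∧ hi ≤ ε⁻¹ := by
    refine ⟨min 1 (min lo hi⁻¹), by positivity, by simp, by simp, ?_⟩
    rw [le_inv_comm₀ hhi0 (by positivity)]
    simp
  have hlog : ∀ t, lo ≤ t → t ≤ hi → truncLog ε t = Real.log t := fun t hlot hthi =>
    truncLog_eq_log (hεlo.trans hlot) (hthi.trans hεhi)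
  obtain ⟨c, g, hk, hk0, hg⟩ :=
    exists_truncated_density hs (by linarith) hF hFm hF0 hb hB m hε0 hε1
  have hmono := truncLog_strictMono hε0 hε1
  refine ⟨c, hi, g, hk, hk0, ?_⟩
  filter_upwards [hg, ae_abs_strictMono_sub_le (half_pos hγ) (half_pos hs) (by linarith)
    (by rwa [← add_div]) hF0 hk0 hB hmono hg] with x hx hbound hFx
  obtain ⟨hlow, hhigh⟩ := abs_le.1 (hbound hFx)
  have hlog_m := hlog m hlom hmhi
  have hlog_lo : truncLog ε lo = Real.log m - 4 * B := by
    rw [hlog lo le_rfl (hlom.trans hmhi), hlo, Real.log_mul hm.ne' (Real.exp_ne_zero _),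
      Real.log_exp, sub_eq_add_neg]
  have hlog_hi : truncLog ε hi = Real.log m + 4 * B := by
    rw [hlog hi (hlom.trans hmhi) le_rfl, hhi, Real.log_mul hm.ne' (Real.exp_ne_zero _),
      Real.log_exp]
  have hlog_le : lo ≤ m + g x := hmono.le_iff_le.1 (by linarith)
  have hle_hi : m + g x ≤ hi := hmono.le_iff_le.1 (by linarith)
  exact ⟨hlo0.trans_le hlog_le, hle_hi, hlog _ hlog_le hle_hi ▸ hx hFx⟩

theorem continuous_and_bounded_mul_log_sub_logPot {α γ s : ℝ} (hγ : 0 < γ) (hs : 0 < s)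
    (hγs : γ + s ≤ 1) {h : Plane → ℝ} (hh : PotAdmissible (γ + s) s h)
    (hmass : ∫ x, h x = 2 * Real.pi * α) :
    Continuous (fun x => α * Real.log (1 + ‖x‖) - logPot h x) ∧
      ∃ B, ∀ x, |α * Real.log (1 + ‖x‖) - logPot h x| ≤ B := by
  constructor
  · have := (hh.mono (le_add_of_nonneg_left hγ.le) hs.le le_rfl).continuous_logPot hs (by linarith)
    fun_prop (disch := intros; positivity)
  · obtain ⟨B, hB⟩ := hh.exists_abs_logPot_sub_log_one_add_le hγ hs hγs
    rw [hmass, inv_mul_cancel_left₀ Real.two_pi_pos.ne'] at hB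
    exact ⟨B, fun x => abs_sub_comm _ (logPot _ x) ▸ hB x⟩

theorem exists_density {γ s : ℝ} (hγ : 0 < γ) (hs : 0 < s) (hγs : γ + s ≤ 1) {F : Plane → ℝ}
    (hF : PotAdmissible (γ + s) s F) (hFm : Measurable F) (hF0 : ∀ x, 0 ≤ F x)
    (hFpos : 0 < ∫ x, F x) {α : ℝ} (hα : 0 < α) :
    ∃ (c : ℝ) (h : Plane → ℝ), PotAdmissible (γ + s) s h ∧ ∫ x, h x = 2 * Real.pi * α ∧
      ∀ᵐ x, h x = F x * (Real.exp (2 * (c + logPot h x)) * (1 + ‖x‖) ^ (-(2 * α))) := by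
  obtain ⟨m, hm, hmF⟩ : ∃ m : ℝ, 0 < m ∧ ∫ x, m * F x = 2 * Real.pi * α :=
    ⟨2 * Real.pi * α / ∫ x, F x, by positivity, by
      rw [integral_const_mul, div_mul_cancel₀ _ hFpos.ne']⟩
  have hmF_adm : PotAdmissible (γ + s) s (fun x => m * F x) :=
    hF.of_abs_le (hF.aestronglyMeasurable.const_mul m) m (Eventually.of_forall fun y => by
      rw [abs_mul, abs_of_pos hm])
  have hmF_adm' := hmF_adm.mono (le_add_of_nonneg_left hγ.le) hs.le le_rfl
  obtain ⟨hb, B, hB⟩ := continuous_and_bounded_mul_log_sub_logPot hγ hs hγs hmF_adm hmF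
  obtain ⟨c, M, g, hk, hk0, hg⟩ := exists_bounded_density hγ hs hγs hF hFm hF0 hb hB hm
  have hk' := hk.mono (show s / 2 ≤ (γ + s) / 2 by linarith) (half_pos hs).le le_rfl
  have hpot : ∀ x, logPot (fun y => (m + g y) * F y) x =
      logPot (fun y => m * F y) x + logPot (fun y => g y * F y) x := fun x => by
    simp only [add_mul]
    exact hmF_adm'.logPot_add hk' hs (half_pos hs) x
  refine ⟨c, fun y => (m + g y) * F y, hF.of_abs_le ?_ M ?_, ?_, ?_⟩
  · simp only [add_mul]
    exact hmF_adm.aestronglyMeasurable.add hk.aestronglyMeasurable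
  · filter_upwards [hg] with y hy
    rcases eq_or_ne (F y) 0 with hFy | hFy
    · simp [hFy]
    · rw [abs_mul, abs_of_pos (hy hFy).1]
      gcongr
      exact (hy hFy).2.1
  · simp only [add_mul]
    rw [integral_add (hmF_adm.integrable (by linarith)) (hk.integrable (by linarith)), hmF, hk0,
      add_zero]
  · filter_upwards [hg] with x hx
    rcases eq_or_ne (F x) 0 with hFx | hFx
    · rw [hFx, mul_zero, zero_mul]
    obtain ⟨hpos, -, heq⟩ := hx hFx
    rw [mul_comm]
    congr 1
    rw [Real.rpow_def_of_pos (by positivity), ← Real.exp_add, ← Real.exp_log hpos, hpot]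
    congr 1
    linarith

section CurvatureDensity

theorem exists_integrable_of_lt_alphaExp {K : Plane → ℝ} (hK : AEMeasurable K volume) {p : ℝ}
    {z : EReal} (hz : z < alphaExp K p) :
    ∃ a : ℝ, z < a ∧ Integrable fun x => |K x| ^ p * (1 + ‖x‖) ^ (2 * a * p + 2 * (p - 1)) := by
  obtain ⟨_, ⟨a, ha, rfl⟩, hza⟩ := lt_sSup_iff.1 hz
  refine ⟨a, hza, ?_, ?_⟩
  · exact ((hK.norm.pow_const p).mul (Measurable.aemeasurable (by fun_prop))).aestronglyMeasurable
  · rw [hasFiniteIntegral_iff_ofReal (Eventually.of_forall fun x => by positivity)]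
    exact ha

theorem exists_potAdmissible_of_lt_alphaExp_sub {K : Plane → ℝ} (hK : AEMeasurable K volume)
    (hp : ∃ p : ℝ, 1 < p ∧ ⊥ < alphaExp K p) {α β : ℝ} (hβ : 0 < β)
    (hαβ : (β : EReal) < alphaExp K 1 - α) :
    ∃ γ s, 2 * β / (1 + 2 * β) < γ ∧ 0 < s ∧ γ + s ≤ 1 ∧
      PotAdmissible (γ + s) s (fun y => |K y| * (1 + ‖y‖) ^ (2 * α)) := by
  obtain ⟨p, hp1, hp⟩ := hp
  rw [EReal.lt_sub_iff_add_lt (Or.inl (EReal.coe_ne_bot _)) (Or.inl (EReal.coe_ne_top _)),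
    ← EReal.coe_add] at hαβ
  obtain ⟨a, ha, hKa⟩ := exists_integrable_of_lt_alphaExp hK hαβ
  obtain ⟨a', -, hKa'⟩ := exists_integrable_of_lt_alphaExp hK hp
  have ha' : β + α < a := by exact_mod_cast ha
  have hK1 : Integrable (fun x : Plane => |K x| * (1 + ‖x‖) ^ (2 * a)) := by simpa using hKa
  obtain ⟨γ, hγ, hγ'⟩ : ∃ γ, 2 * β / (1 + 2 * β) < γ ∧ γ < min (2 * β) 1 := by
    refine exists_between (lt_min ?_ ?_)
    · exact div_lt_self (by positivity) (by linarith)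
    · exact (div_lt_one (by positivity)).2 (by linarith)
  obtain ⟨hγβ, hγ1⟩ := lt_min_iff.1 hγ'
  set t := min (2 * β - γ) (1 - γ)
  have ht : 0 < t := lt_min (by linarith) (by linarith)
  have htβ : t ≤ 2 * β - γ := min_le_left _ _
  have ht1 : t ≤ 1 - γ := min_le_right _ _
  obtain ⟨s₀, hs₀, h⟩ := exists_potAdmissible_abs_mul_rpow (κ := 2 * α) (τ := γ + t) hK hp1 hK1
    hKa' (by linarith)
  have hs : 0 < min s₀ t := lt_min hs₀ ht
  have hst : min s₀ t ≤ t := min_le_right _ _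
  exact ⟨γ, min s₀ t, hγ, hs, by linarith,
    (h _ hs.le (min_le_left _ _)).mono (by linarith) hs.le le_rfl⟩

theorem exists_potAdmissible_of_lt_alphaExp {K : Plane → ℝ} (hK : AEMeasurable K volume)
    (hp : ∃ p : ℝ, 1 < p ∧ ⊥ < alphaExp K p) {α : ℝ} (hα : (α : EReal) < alphaExp K 1) :
    ∃ γ s, 0 < γ ∧ 0 < s ∧ γ + s ≤ 1 ∧
      PotAdmissible (γ + s) s (fun y => |K y| * (1 + ‖y‖) ^ (2 * α)) := by
  obtain ⟨β, hβ, hαβ⟩ := EReal.lt_iff_exists_real_btwn.1 (EReal.sub_pos.2 hα)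
  have hβ_pos : 0 < β := by exact_mod_cast hβ
  obtain ⟨γ, s, hγ, hs⟩ := exists_potAdmissible_of_lt_alphaExp_sub hK hp hβ_pos hαβ
  exact ⟨γ, s, lt_trans (by positivity) hγ, hs⟩

/-- The density `|K| e^{2v}`. It is `-K e^{2v}` when `K ≤ 0`, so that a solution `v` of
`Δv + K e^{2v} = 0` differs from the logarithmic potential of this density by a harmonic
function. -/
noncomputable def curvatureDensity (K v : Plane → ℝ) (y : Plane) : ℝ :=
  |K y| * Real.exp (2 * v y)

variable {K u v : Plane → ℝ} {α γ s τ : ℝ}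

theorem curvatureDensity_le_curvatureDensity {y : Plane} (h : u y ≤ v y) :
    curvatureDensity K u y ≤ curvatureDensity K v y :=
  mul_le_mul_of_nonneg_left (Real.exp_le_exp.2 (by linarith)) (abs_nonneg _)

theorem neg_curvatureDensity_ae_eq (hK : ∀ᵐ x, K x ≤ 0) (v : Plane → ℝ) :
    (fun y => -curvatureDensity K v y) =ᵐ[volume] fun y => K y * Real.exp (2 * v y) := by
  filter_upwards [hK] with y hy
  rw [curvatureDensity, abs_of_nonpos hy, neg_mul, neg_neg]

theorem potAdmissible_curvatureDensity
    (hF : PotAdmissible τ s (fun y => |K y| * (1 + ‖y‖) ^ (2 * α))) (hK : AEMeasurable K volume)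
    (hv : Continuous v) (hg : HasLogGrowth α v) : PotAdmissible τ s (curvatureDensity K v) := by
  obtain ⟨C, hC⟩ := hg.exists_abs_sub_log_one_add_le hv
  refine hF.of_abs_le (hK.norm.aestronglyMeasurable.mul
    (Continuous.aestronglyMeasurable (by fun_prop))) (Real.exp (2 * C))
    (Eventually.of_forall fun y => ?_)
  have hexp : Real.exp (2 * v y) ≤ Real.exp (2 * C) * (1 + ‖y‖) ^ (2 * α) := by
    rw [Real.rpow_def_of_pos (by positivity), ← Real.exp_add, Real.exp_le_exp]
    linarith [(abs_le.1 (hC y)).2]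
  rw [curvatureDensity, abs_mul, abs_mul, abs_abs, Real.abs_exp,
    abs_of_pos (by positivity : 0 < (1 + ‖y‖) ^ (2 * α)), mul_left_comm (Real.exp _)]
  gcongr

end CurvatureDensity

section Representation

variable {K u v : Plane → ℝ} {α γ s : ℝ}

theorem integral_sub_logPot_mul_laplacian (hv : Continuous v) {h : Plane → ℝ}
    (hh : PotAdmissible s s h) (hs : 0 < s) (hs1 : s ≤ 1) {φ : Plane → ℝ} (hφ : ContDiff ℝ ∞ φ)
    (hc : HasCompactSupport φ) :
    ∫ x, (v x - logPot h x) * Laplacian.laplacian φ x =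
      (∫ x, v x * Laplacian.laplacian φ x) - ∫ x, h x * φ x := by
  have hcont := continuous_laplacian hφ
  have hsupp := hasCompactSupport_laplacian hc
  simp_rw [sub_mul]
  rw [← integral_logPot_mul_laplacian hh hs hφ hc]
  exact integral_sub ((hv.mul hcont).integrable_of_hasCompactSupport hsupp.mul_left)
    (((hh.continuous_logPot hs hs1).mul hcont).integrable_of_hasCompactSupport hsupp.mul_left)

theorem isCurvatureSolution_iff_weakly_harmonic (hK : ∀ᵐ x, K x ≤ 0) (hs : 0 < s) (hs1 : s ≤ 1)
    (hh : PotAdmissible s s (curvatureDensity K v)) (hv : Continuous v) :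
    IsCurvatureSolution K v ↔ ∀ φ : Plane → ℝ, ContDiff ℝ ∞ φ → HasCompactSupport φ →
      ∫ x, (v x - logPot (curvatureDensity K v) x) * Laplacian.laplacian φ x = 0 := by
  have hweak : ∀ φ : Plane → ℝ, ContDiff ℝ ∞ φ → HasCompactSupport φ →
      ∫ x, (v x - logPot (curvatureDensity K v) x) * Laplacian.laplacian φ x =
        (∫ x, v x * Laplacian.laplacian φ x) + ∫ x, K x * Real.exp (2 * v x) * φ x := by
    intro φ hφ hc
    rw [integral_sub_logPot_mul_laplacian hv hh hs hs1 hφ hc, sub_eq_add_neg, ← integral_neg]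
    congr 1
    refine integral_congr_ae ?_
    filter_upwards [neg_curvatureDensity_ae_eq hK v] with y hy
    rw [← hy, neg_mul]
  exact ⟨fun h φ hφ hc => (hweak φ hφ hc).trans (h.weak φ hφ hc),
    fun h => ⟨hv, fun φ hφ hc => (hweak φ hφ hc).symm.trans (h φ hφ hc)⟩⟩

theorem eq_zero_of_abs_mul_log_le {a C : ℝ} (h : ∀ x : Plane, |a * Real.log (1 + ‖x‖)| ≤ C) :
    a = 0 := by
  by_contra ha
  have hlim : Tendsto (fun r : ℝ => |a| * Real.log (1 + r)) atTop atTop :=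
    (Real.tendsto_log_atTop.comp (tendsto_atTop_add_const_left _ _ tendsto_id)).const_mul_atTop
      (abs_pos.2 ha)
  obtain ⟨r, hCr, hr⟩ := ((hlim.eventually_gt_atTop C).and (eventually_ge_atTop 0)).exists
  have hle := h (planeIso r)
  rw [planeIso.norm_map, Complex.norm_real, Real.norm_of_nonneg hr, abs_mul,
    abs_of_nonneg (Real.log_nonneg (by linarith))] at hle
  linarith

theorem eq_zero_and_eq_of_weakly_harmonic {w : Plane → ℝ} (hw : Continuous w)
    (hweak : ∀ φ : Plane → ℝ, ContDiff ℝ ∞ φ → HasCompactSupport φ →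
      ∫ x, w x * Laplacian.laplacian φ x = 0) {a C : ℝ}
    (hC : ∀ x, |w x - a * Real.log (1 + ‖x‖)| ≤ C) : a = 0 ∧ ∀ x y, w x = w y := by
  have hlittle : (fun R => |a| * Real.log (1 + R) + C) =o[atTop] fun R : ℝ => R := by
    have hlog := isLittleO_comp_add_one Real.isLittleO_log_id_atTop
    simp only [add_comm _ (1 : ℝ)] at hlog
    exact (hlog.const_mul_left |a|).add (isLittleO_const_id_atTop C)
  have hle : ∀ R x, ‖x‖ ≤ R → w x ≤ |a| * Real.log (1 + R) + C := fun R x hx => by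
    have hlog : a * Real.log (1 + ‖x‖) ≤ |a| * Real.log (1 + R) :=
      mul_le_mul (le_abs_self a) (Real.log_le_log (by positivity) (by linarith))
        (Real.log_nonneg (by linarith [norm_nonneg x])) (abs_nonneg a)
    linarith [(abs_le.1 (hC x)).2]
  have hconst := eq_of_weakly_harmonic hw hweak hlittle hle
  refine ⟨eq_zero_of_abs_mul_log_le (C := C + |w 0|) fun x => ?_, hconst⟩
  calc |a * Real.log (1 + ‖x‖)| = |w 0 - (w x - a * Real.log (1 + ‖x‖))| := by
        rw [hconst x 0, sub_sub_cancel]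
    _ ≤ |w 0| + |w x - a * Real.log (1 + ‖x‖)| := abs_sub _ _
    _ ≤ C + |w 0| := by linarith [hC x]

theorem IsCurvatureSolution.exists_eq_const_add_logPot (hγ : 0 < γ) (hs : 0 < s) (hγs : γ + s ≤ 1)
    (hK : ∀ᵐ x, K x ≤ 0) (hv : IsCurvatureSolution K v) (hg : HasLogGrowth α v)
    (hh : PotAdmissible (γ + s) s (curvatureDensity K v)) :
    (∃ c, ∀ x, v x = c + logPot (curvatureDensity K v) x) ∧
      ∫ y, curvatureDensity K v y = 2 * Real.pi * α := by
  have hh' := hh.mono (le_add_of_nonneg_left hγ.le) hs.le le_rfl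
  have hs1 : s ≤ 1 := by linarith
  set m := (2 * Real.pi)⁻¹ * ∫ y, curvatureDensity K v y with hm
  obtain ⟨C, hC⟩ := hg.exists_abs_sub_log_one_add_le hv.continuous
  obtain ⟨D, hD⟩ := hh.exists_abs_logPot_sub_log_one_add_le hγ hs hγs
  have hlog : ∀ x, |v x - logPot (curvatureDensity K v) x - (α - m) * Real.log (1 + ‖x‖)| ≤
      C + D := fun x => by
    calc _ = |(v x - α * Real.log (1 + ‖x‖)) -
          (logPot (curvatureDensity K v) x - m * Real.log (1 + ‖x‖))| := by
          congr 1
          ring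
      _ ≤ C + D := (abs_sub _ _).trans (add_le_add (hC x) (hD x))
  obtain ⟨hαm, hconst⟩ := eq_zero_and_eq_of_weakly_harmonic
    (hv.continuous.sub (hh'.continuous_logPot hs hs1))
    ((isCurvatureSolution_iff_weakly_harmonic hK hs hs1 hh' hv.continuous).1 hv) hlog
  refine ⟨⟨v 0 - logPot (curvatureDensity K v) 0, fun x => ?_⟩, ?_⟩
  · exact sub_eq_iff_eq_add.1 (hconst x 0)
  · rw [sub_eq_zero.1 hαm, hm, mul_inv_cancel_left₀ Real.two_pi_pos.ne']

theorem isCurvatureSolution_of_eq_const_add_logPot (hK : ∀ᵐ x, K x ≤ 0) (hs : 0 < s) (hs1 : s ≤ 1)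
    (hh : PotAdmissible s s (curvatureDensity K u)) {c : ℝ}
    (hu : ∀ x, u x = c + logPot (curvatureDensity K u) x) : IsCurvatureSolution K u := by
  have hcont : Continuous u := by
    rw [funext hu]
    exact continuous_const.add (hh.continuous_logPot hs hs1)
  refine (isCurvatureSolution_iff_weakly_harmonic hK hs hs1 hh hcont).2 fun φ hφ hc => ?_
  have hzero : ∫ x, Laplacian.laplacian φ x = 0 := by
    simpa using integral_mul_laplacian (f := fun _ : Plane => (1 : ℝ)) contDiff_const hφ hc
  calc _ = ∫ x, c * Laplacian.laplacian φ x := by simp_rw [hu, add_sub_cancel_right]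
    _ = 0 := by rw [integral_const_mul, hzero, mul_zero]

theorem hasLogGrowth_of_eq_const_add_logPot (hγ : 0 < γ) (hs : 0 < s) (hγs : γ + s ≤ 1)
    (hh : PotAdmissible (γ + s) s (curvatureDensity K u)) {c : ℝ}
    (hu : ∀ x, u x = c + logPot (curvatureDensity K u) x) :
    HasLogGrowth ((2 * Real.pi)⁻¹ * ∫ y, curvatureDensity K u y) u := by
  refine ((isBigO_const_one ℝ c _).add (hh.hasLogGrowth_logPot hγ hs hγs)).congr_left fun x => ?_
  rw [hu x, add_sub_assoc]

end Representation

section Uniqueness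

variable {K u v : Plane → ℝ} {α γ s : ℝ}

theorem eq_of_curvatureDensity_ae_eq (hK0 : ¬ ∀ᵐ x, K x = 0) {c d : ℝ}
    (hu : ∀ x, u x = c + logPot (curvatureDensity K u) x)
    (hv : ∀ x, v x = d + logPot (curvatureDensity K v) x)
    (huv : curvatureDensity K u =ᵐ[volume] curvatureDensity K v) : u = v := by
  obtain ⟨y, hy, hKy⟩ : ∃ y, curvatureDensity K u y = curvatureDensity K v y ∧ K y ≠ 0 := by
    by_contra! hcon
    exact hK0 (huv.mono hcon)
  have huvy : u y = v y := by
    linarith [Real.exp_injective (mul_left_cancel₀ (abs_ne_zero.2 hKy) hy)]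
  have hcd : c = d := by
    rw [hu, hv, logPot_congr_ae huv] at huvy
    exact add_right_cancel huvy
  ext x
  rw [hu, hv, hcd, logPot_congr_ae huv]

theorem IsCurvatureSolution.unique (hγ : 0 < γ) (hs : 0 < s) (hγs : γ + s ≤ 1)
    (hKm : AEMeasurable K volume) (hK : ∀ᵐ x, K x ≤ 0) (hK0 : ¬ ∀ᵐ x, K x = 0)
    (hF : PotAdmissible (γ + s) s (fun y => |K y| * (1 + ‖y‖) ^ (2 * α)))
    (hu : IsCurvatureSolution K u) (hug : HasLogGrowth α u)
    (hv : IsCurvatureSolution K v) (hvg : HasLogGrowth α v) : u = v := by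
  have hadu := potAdmissible_curvatureDensity hF hKm hu.continuous hug
  have hadv := potAdmissible_curvatureDensity hF hKm hv.continuous hvg
  obtain ⟨⟨c, hc⟩, hmass_u⟩ := hu.exists_eq_const_add_logPot hγ hs hγs hK hug hadu
  obtain ⟨⟨d, hd⟩, hmass_v⟩ := hv.exists_eq_const_add_logPot hγ hs hγs hK hvg hadv
  set k : Plane → ℝ := fun y => curvatureDensity K u y - curvatureDensity K v y
  have hk0 : ∫ y, k y = 0 := by
    rw [integral_sub (hadu.integrable (by linarith)) (hadv.integrable (by linarith)), hmass_u,
      hmass_v, sub_self]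
  have hpot : ∀ x, logPot k x = u x - v x + (d - c) := fun x => by
    have hsγ : s ≤ γ + s := le_add_of_nonneg_left hγ.le
    rw [(hadu.mono hsγ hs.le le_rfl).logPot_sub (hadv.mono hsγ hs.le le_rfl) hs hs, hc x, hd x]
    ring
  have hup : ∀ x, d - c + 0 < logPot k x → 0 ≤ k x := fun x hx =>
    sub_nonneg.2 (curvatureDensity_le_curvatureDensity (by linarith [hpot x]))
  have hdown : ∀ x, logPot k x < d - c - 0 → k x ≤ 0 := fun x hx =>
    sub_nonpos.2 (curvatureDensity_le_curvatureDensity (by linarith [hpot x]))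
  rcases abs_logPot_sub_le_or_ae_eq_zero (hadu.sub hadv) hγ hs hγs hk0
    (Eventually.of_forall hup) (Eventually.of_forall hdown) with hle | h0
  · ext x
    have hzero := abs_nonpos_iff.1 (hle x)
    linarith [hpot x]
  · exact eq_of_curvatureDensity_ae_eq hK0 hc hd (h0.mono fun y hy => sub_eq_zero.1 hy)

end Uniqueness

theorem integral_abs_mul_rpow_pos {E : Type*} [NormedAddCommGroup E] [MeasurableSpace E]
    {μ : Measure E} {K : E → ℝ} {κ : ℝ} (hint : Integrable (fun y => |K y| * (1 + ‖y‖) ^ κ) μ)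
    (hK0 : ¬ ∀ᵐ x ∂μ, K x = 0) : 0 < ∫ y, |K y| * (1 + ‖y‖) ^ κ ∂μ := by
  have hnonneg : ∀ y, 0 ≤ |K y| * (1 + ‖y‖) ^ κ := fun y => by positivity
  refine (integral_nonneg hnonneg).lt_of_ne fun hzero => hK0 ?_
  filter_upwards [(integral_eq_zero_iff_of_nonneg hnonneg hint).1 hzero.symm] with y hy
  have : (1 + ‖y‖) ^ κ ≠ 0 := by positivity
  exact abs_eq_zero.1 ((mul_eq_zero.1 hy).resolve_right this)

theorem exists_eq_const_add_logPot_curvatureDensity {α γ s : ℝ} (hα : 0 < α) (hγ : 0 < γ)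
    (hs : 0 < s) (hγs : γ + s ≤ 1) {K : Plane → ℝ} (hKm : AEMeasurable K volume)
    (hK0 : ¬ ∀ᵐ x, K x = 0)
    (hF : PotAdmissible (γ + s) s (fun y => |K y| * (1 + ‖y‖) ^ (2 * α))) :
    ∃ (u : Plane → ℝ) (c : ℝ), PotAdmissible (γ + s) s (curvatureDensity K u) ∧
      (∀ x, u x = c + logPot (curvatureDensity K u) x) ∧
      ∫ y, curvatureDensity K u y = 2 * Real.pi * α := by
  set F : Plane → ℝ := fun y => |hKm.mk K y| * (1 + ‖y‖) ^ (2 * α) with hFdef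
  have hFm : Measurable F := hKm.measurable_mk.norm.mul (by fun_prop)
  have hF0 : ∀ x, 0 ≤ F x := fun x => by positivity
  have hFK : F =ᵐ[volume] fun y => |K y| * (1 + ‖y‖) ^ (2 * α) := by
    filter_upwards [hKm.ae_eq_mk] with y hy
    rw [hFdef, hy]
  have hF_adm : PotAdmissible (γ + s) s F :=
    hF.of_abs_le hFm.aestronglyMeasurable 1 (by
      filter_upwards [hFK] with y hy
      rw [hy, one_mul])
  have hFpos : 0 < ∫ x, F x := by
    rw [integral_congr_ae hFK]
    exact integral_abs_mul_rpow_pos (hF.integrable (by linarith)) hK0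
  obtain ⟨c, h, hadm, hmass, hh⟩ := exists_density hγ hs hγs hF_adm hFm hF0 hFpos hα
  have hhK : h =ᵐ[volume] curvatureDensity K (fun x => c + logPot h x) := by
    filter_upwards [hh, hFK] with y hy hFy
    rw [hy, hFy, curvatureDensity, Real.rpow_neg (by positivity)]
    field_simp
  refine ⟨fun x => c + logPot h x, c, ?_, fun x => by rw [← logPot_congr_ae hhK], ?_⟩
  · exact hadm.of_abs_le (hadm.aestronglyMeasurable.congr hhK) 1 (by
      filter_upwards [hhK] with y hy
      rw [← hy, one_mul])
  · rw [← integral_congr_ae hhK, hmass]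

theorem exists_curvatureSolution {α γ s : ℝ} (hα : 0 < α) (hγ : 0 < γ) (hs : 0 < s)
    (hγs : γ + s ≤ 1) {K : Plane → ℝ} (hKm : AEMeasurable K volume) (hK : ∀ᵐ x, K x ≤ 0)
    (hK0 : ¬ ∀ᵐ x, K x = 0)
    (hF : PotAdmissible (γ + s) s (fun y => |K y| * (1 + ‖y‖) ^ (2 * α))) :
    ∃ u : Plane → ℝ, IsCurvatureSolution K u ∧ HasLogGrowth α u := by
  obtain ⟨u, c, hadm, hrep, hmass⟩ :=
    exists_eq_const_add_logPot_curvatureDensity hα hγ hs hγs hKm hK0 hF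
  refine ⟨u, isCurvatureSolution_of_eq_const_add_logPot hK hs (by linarith)
    (hadm.mono (le_add_of_nonneg_left hγ.le) hs.le le_rfl) hrep, ?_⟩
  have hug := hasLogGrowth_of_eq_const_add_logPot hγ hs hγs hadm hrep
  rwa [hmass, inv_mul_cancel_left₀ Real.two_pi_pos.ne'] at hug

theorem isLittleO_rpow_neg_rpow_neg {a b : ℝ} (hab : a < b) :
    (fun r : ℝ => r ^ (-b)) =o[atTop] fun r : ℝ => r ^ (-a) := by
  refine isLittleO_of_tendsto' ?_ ((tendsto_rpow_neg_atTop (sub_pos.2 hab)).congr' ?_)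
  · filter_upwards [eventually_gt_atTop 0] with r hr hzero
    exact absurd hzero (Real.rpow_pos_of_pos hr _).ne'
  · filter_upwards [eventually_gt_atTop 0] with r hr
    rw [← Real.rpow_sub hr]
    congr 1
    ring

theorem PotAdmissible.logPot_sub_log_isLittleO {γ s b : ℝ} {h : Plane → ℝ}
    (hh : PotAdmissible (γ + s) s h) (hγ : 0 < γ) (hs : 0 < s) (hγs : γ + s ≤ 1) (hb : b < γ) :
    (fun x => logPot h x - (2 * Real.pi)⁻¹ * (∫ y, h y) * Real.log ‖x‖)
      =o[cocompact Plane] fun x => ‖x‖ ^ (-b) := by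
  obtain ⟨C, hC⟩ := hh.exists_abs_logPot_sub_log_le hγ hs hγs
  have hbigO : (fun x => logPot h x - (2 * Real.pi)⁻¹ * (∫ y, h y) * Real.log ‖x‖)
      =O[cocompact Plane] fun x => ‖x‖ ^ (-γ) := by
    refine IsBigO.of_bound C ?_
    filter_upwards [(isCompact_singleton (x := (0 : Plane))).compl_mem_cocompact] with x hx
    rw [Real.norm_eq_abs, Real.norm_of_nonneg (by positivity)]
    exact hC x hx
  exact hbigO.trans_isLittleO
    ((isLittleO_rpow_neg_rpow_neg hb).comp_tendsto tendsto_norm_cocompact_atTop)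

theorem theorem1p1_general (K : Plane → ℝ)
    (hK_meas : AEMeasurable K volume)
    (hK_nonpos : ∀ᵐ x : Plane, K x ≤ 0)
    (hK_nontriv : ¬ (∀ᵐ x : Plane, K x = 0))
    (hp : ∃ p : ℝ, 1 < p ∧ ⊥ < alphaExp K p)
    (α : ℝ) (hα_pos : 0 < α) (hα_lt : (α : EReal) < alphaExp K 1) :
    ∃ u : Plane → ℝ,
      (IsCurvatureSolution K u ∧ HasLogGrowth α u) ∧
      (∀ v : Plane → ℝ, IsCurvatureSolution K v → HasLogGrowth α v → v = u) ∧
      (Integrable (fun x : Plane => K x * Real.exp (2 * u x)) volume ∧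
        ∫ x : Plane, K x * Real.exp (2 * u x) = -(2 * α * Real.pi)) ∧
      ∃ c : ℝ, ∀ β : ℝ, 0 < β → (β : EReal) < alphaExp K 1 - (α : EReal) →
        (fun x : Plane => u x - α * Real.log ‖x‖ - c)
          =o[cocompact Plane] (fun x : Plane => ‖x‖ ^ (-(2 * β / (1 + 2 * β)))) := by
  obtain ⟨γ, s, hγ, hs, hγs, hF⟩ := exists_potAdmissible_of_lt_alphaExp hK_meas hp hα_lt
  obtain ⟨u, hu, hug⟩ :=
    exists_curvatureSolution hα_pos hγ hs hγs hK_meas hK_nonpos hK_nontriv hF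
  have hadm := potAdmissible_curvatureDensity hF hK_meas hu.continuous hug
  obtain ⟨⟨c, hrep⟩, hmass⟩ := hu.exists_eq_const_add_logPot hγ hs hγs hK_nonpos hug hadm
  have hdensity := neg_curvatureDensity_ae_eq hK_nonpos u
  refine ⟨u, ⟨hu, hug⟩, fun v hv hvg => hv.unique hγ hs hγs hK_meas hK_nonpos hK_nontriv hF hvg
    hu hug, ⟨(hadm.integrable (by linarith)).neg.congr hdensity, ?_⟩, c, fun β hβ hαβ => ?_⟩
  · rw [← integral_congr_ae hdensity, integral_neg, hmass, mul_right_comm]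
  · obtain ⟨δ, t, hβδ, ht, hδt, hFt⟩ :=
      exists_potAdmissible_of_lt_alphaExp_sub hK_meas hp hβ hαβ
    have hδ : 0 < δ := lt_trans (by positivity) hβδ
    refine ((potAdmissible_curvatureDensity hFt hK_meas hu.continuous
      hug).logPot_sub_log_isLittleO hδ ht hδt hβδ).congr_left fun x => ?_
    rw [hmass, inv_mul_cancel_left₀ Real.two_pi_pos.ne', hrep x]
    ring

theorem theorem1p1 (K : Plane → ℝ)
    (hK_meas : AEMeasurable K volume)
    (hK_nonpos : ∀ᵐ x : Plane, K x ≤ 0)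
    (hK_nontriv : ¬ (∀ᵐ x : Plane, K x = 0))
    (hK_bdd : IsLocBounded K)
    (h1 : 0 < alphaExp K 1)
    (hp : ∃ p : ℝ, 1 < p ∧ ⊥ < alphaExp K p)
    (α : ℝ) (hα_pos : 0 < α) (hα_lt : (α : EReal) < alphaExp K 1) :
    ∃ u : Plane → ℝ,
      (IsCurvatureSolution K u ∧ HasLogGrowth α u) ∧
      (∀ v : Plane → ℝ, IsCurvatureSolution K v → HasLogGrowth α v → v = u) ∧
      (Integrable (fun x : Plane => K x * Real.exp (2 * u x)) volume ∧
        ∫ x : Plane, K x * Real.exp (2 * u x) = -(2 * α * Real.pi)) ∧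
      ∃ c : ℝ, ∀ β : ℝ, 0 < β → (β : EReal) < alphaExp K 1 - (α : EReal) →
        (fun x : Plane => u x - α * Real.log ‖x‖ - c)
          =o[cocompact Plane] (fun x : Plane => ‖x‖ ^ (-(2 * β / (1 + 2 * β)))) :=
  theorem1p1_general K hK_meas hK_nonpos hK_nontriv hp α hα_pos hα_lt
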